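/- Let $d\ge 1$ and let $\mathcal B$, $\mathcal B_0$ denote the linear operators and the traceless linear operators on $\mathbb C^d$. For a finite set $A\subset\mathbb Z$ put $\mathcal B_0^A=\mathcal B_0^{\otimes A}$ (with $\mathcal B_0^\emptyset=\mathbb C$). A formal operator on the infinite chain is a family $\Phi=\sum_A\Phi(A)$ with $\Phi(A)\in\mathcal B_0^A$ for every finite $A\subset\mathbb Z$. It is at most $n$-local if $\Phi(A)=0$ whenever $A\ne\emptyset$ and $\max A-\min A+1>n$, local if it is at most $n$-local for some $n$, Hermitian if every $\Phi(A)$ is, and translation invariant if $\Phi(A+x)$ is the translate of $\Phi(A)$ by $x$ for all $A$ and all $x\in\mathbb Z$. For finite $B\subset\mathbb Z$ let $\Phi|_B=\sum_{A\subseteq B}\Phi(A)\otimes I_{B\setminus A}\in\mathcal B^{\otimes B}$, and for $Y\in\mathcal B^{\otimes B}=\bigoplus_{A\subseteq B}\mathcal B_0^A$ let $Y_A$ be its component in $\mathcal B_0^A$. For $\Phi$ local and $\Psi$ arbitrary, the commutator is the formal operator $[\Phi,\Psi](A)=\big[\Phi|_B,\Psi|_B\big]_A$, where $B\supseteq A$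 is any sufficiently large finite set (the value does not depend on its choice). Let $H=\sum_{j\in\mathbb Z}(h^{(2)}_j+h^{(1)}_j)$ with $h^{(2)}_j\in\mathcal B_0^{\{j,j+1\}}$ and $h^{(1)}_j\in\mathcal B_0^{\{j\}}$ be Hermitian and translation invariant, let $C$ be any translation-invariant formal operator that is at most $1$-local, and let $$B_H=\sum_{j\in\mathbb Z}j\,\big(h^{(2)}_j+h^{(1)}_j\big)+C .$$ Define $Q^{(2)}=H$ and $Q^{(n+1)}=[B_H,Q^{(n)}]$ for $n\ge 2$. If $[H,Q^{(3)}]=0$, then for every $n\ge 2$ the operator $Q^{(n)}$ is at most $n$-local, is translation invariant and satisfies $[H,Q^{(n)}]=0$; moreover $[Q^{(m)},Q^{(n)}]=0$ for all $m,n\ge 2$. -/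

import Mathlib

namespace SpinChain

/-- Linear operators on the tensor product of one copy of `ℂ^d` for each site of `A`, as matrices
in the product basis, which is labelled by the configurations `A → Fin d`. -/
abbrev Op (d : ℕ) (A : Finset ℤ) : Type := Matrix (A → Fin d) (A → Fin d) ℂ

/-- The tensor product of one-site operators, one for each site of `A`. -/
def prodOp {d : ℕ} {A : Finset ℤ} (X : A → Matrix (Fin d) (Fin d) ℂ) : Op d A :=
  Matrix.of fun σ σ' => ∏ a, X a (σ a) (σ' a)

/-- The tensor product over the sites of `A` of the spaces of traceless one-site operators. For
`A = ∅` it consists of the scalars. -/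
def tracelessOps (d : ℕ) (A : Finset ℤ) : Submodule ℂ (Op d A) :=
  Submodule.span ℂ {Y | ∃ X : A → Matrix (Fin d) (Fin d) ℂ, (∀ a, (X a).trace = 0) ∧ Y = prodOp X}

/-- A formal operator `Φ = ∑_A Φ(A)` on the infinite chain: a family indexed by the finite sets `A`
of sites, where `Φ(A)` is a tensor product of traceless operators on the sites of `A`. -/
abbrev FormalOp (d : ℕ) : Type := (A : Finset ℤ) → tracelessOps d A

/-- `X ↦ X ⊗ 1`, where the identity acts on the sites of `B` outside `A`. -/
def embed {d : ℕ} {A B : Finset ℤ} (h : A ⊆ B) (X : Op d A) : Op d B :=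
  Matrix.of fun σ σ' =>
    if ∀ b : B, b.1 ∉ A → σ b = σ' b then
      X (fun a => σ ⟨a.1, h a.2⟩) (fun a => σ' ⟨a.1, h a.2⟩)
    else 0

/-- The restriction `Φ|_B = ∑_{A ⊆ B} Φ(A)`. -/
def restrict {d : ℕ} (Φ : FormalOp d) (B : Finset ℤ) : Op d B :=
  ∑ A : {A : Finset ℤ // A ∈ B.powerset}, embed (Finset.mem_powerset.1 A.2) (Φ A.1 : Op d A.1)

/-- The traceless part of a one-site operator. -/
noncomputable def tracelessPart {d : ℕ} (X : Matrix (Fin d) (Fin d) ℂ) :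
    Matrix (Fin d) (Fin d) ℂ :=
  X - (X.trace / d) • (1 : Matrix (Fin d) (Fin d) ℂ)

theorem trace_tracelessPart {d : ℕ} [NeZero d] (X : Matrix (Fin d) (Fin d) ℂ) :
    (tracelessPart X).trace = 0 := by
  have hd : (d : ℂ) ≠ 0 := Nat.cast_ne_zero.2 (NeZero.ne d)
  simp [tracelessPart, Matrix.trace_sub, Matrix.trace_smul, hd]

/-- The component `Y_A` of `Y` in the decomposition of the operators on `B` as the direct sum, over
`A ⊆ B`, of `tracelessOps d A`. It is the linear map that sends a product operator `⊗_{b ∈ B} X_b`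
to `∏_{b ∈ B ∖ A} (tr X_b / d) · ⊗_{a ∈ A} (X_a - (tr X_a / d) 1)`, written out here through the
expansion of `Y` in tensor products of matrix units. -/
noncomputable def component {d : ℕ} [NeZero d] {A B : Finset ℤ} (h : A ⊆ B) (Y : Op d B) :
    tracelessOps d A :=
  ∑ σ : B → Fin d, ∑ σ' : B → Fin d,
    (Y σ σ' * ∏ b : B, if b.1 ∈ A then 1 else
        (Matrix.single (σ b) (σ' b) (1 : ℂ)).trace / d) •
      (⟨prodOp fun a : A => tracelessPart
          (Matrix.single (σ ⟨a.1, h a.2⟩) (σ' ⟨a.1, h a.2⟩) (1 : ℂ)),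
        Submodule.subset_span ⟨_, fun _ => trace_tracelessPart _, rfl⟩⟩ : tracelessOps d A)

/-- `Z` is the value of `[Φ|_B, Ψ|_B]_A` for every sufficiently large finite set `B` of sites. -/
def IsCommAt {d : ℕ} [NeZero d] (Φ Ψ : FormalOp d) (A : Finset ℤ) (Z : tracelessOps d A) : Prop :=
  ∃ B₀ : Finset ℤ, ∀ B : Finset ℤ, B₀ ⊆ B → ∀ h : A ⊆ B,
    component h (restrict Φ B * restrict Ψ B - restrict Ψ B * restrict Φ B) = Z

open Classical in
/-- The commutator `[Φ, Ψ]`, whose value at `A` is `[Φ|_B, Ψ|_B]_A` for any sufficiently large `B`.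
Such a stable value exists and is unique when `Φ` is local: see `isCommAt_comm` below. -/
noncomputable def comm {d : ℕ} [NeZero d] (Φ Ψ : FormalOp d) : FormalOp d := fun A =>
  if h : ∃ Z, IsCommAt Φ Ψ A Z then h.choose else 0

/-- The range `max A - min A + 1` of a finite set of sites; it is `0` for the empty set. -/
def setRange (A : Finset ℤ) : ℕ :=
  if h : A.Nonempty then (A.max' h - A.min' h + 1).toNat else 0

/-- `Φ` is a sum of terms that act on at most `n` contiguous sites. -/
def AtMostLocal {d : ℕ} (n : ℕ) (Φ : FormalOp d) : Prop :=
  ∀ A, Φ A ≠ 0 → setRange A ≤ n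

section WellDefined

variable {d : ℕ}

theorem prodOp_mul {A : Finset ℤ} (X Y : A → Matrix (Fin d) (Fin d) ℂ) :
    prodOp X * prodOp Y = prodOp fun a => X a * Y a := by
  ext σ σ'
  simp only [prodOp, Matrix.mul_apply, Matrix.of_apply, Finset.prod_univ_sum,
    Fintype.piFinset_univ, ← Finset.prod_mul_distrib]

theorem embed_prodOp {A B : Finset ℤ} (h : A ⊆ B) (X : A → Matrix (Fin d) (Fin d) ℂ) :
    embed h (prodOp X) = prodOp fun b : B => if hb : b.1 ∈ A then X ⟨b.1, hb⟩ else 1 := by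
  ext σ σ'
  simp only [embed, prodOp, Matrix.of_apply]
  have e : (∏ b : B, (if hb : b.1 ∈ A then X ⟨b.1, hb⟩ else 1) (σ b) (σ' b)) =
      (∏ a : A, X a (σ ⟨a.1, h a.2⟩) (σ' ⟨a.1, h a.2⟩)) *
        ∏ b : B, (if b.1 ∈ A then 1 else (1 : Matrix (Fin d) (Fin d) ℂ) (σ b) (σ' b)) := by
    have : (∏ a : A, X a (σ ⟨a.1, h a.2⟩) (σ' ⟨a.1, h a.2⟩)) =
        ∏ b : B, (if hb : b.1 ∈ A then X ⟨b.1, hb⟩ (σ b) (σ' b) else 1) := by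
      refine Finset.prod_of_injOn (fun a : A => (⟨a.1, h a.2⟩ : B)) ?_ ?_ ?_ ?_
      · intro a _ b _ hab; exact Subtype.ext (congrArg (fun b : B => b.1) hab)
      · intro a _; simp
      · intro b _ hb
        rw [dif_neg]
        intro hbA
        exact hb ⟨⟨b.1, hbA⟩, by simp, rfl⟩
      · intro a _; simp
    rw [this, ← Finset.prod_mul_distrib]
    refine Finset.prod_congr rfl fun b _ => ?_
    split_ifs <;> simp
  rw [e]
  split_ifs with hc
  · rw [Finset.prod_eq_one (s := Finset.univ) (f := fun b : B => if b.1 ∈ A then (1 : ℂ) else _),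
      mul_one]
    intro b _
    split_ifs with hb
    · rfl
    · rw [hc b hb, Matrix.one_apply_eq]
  · push Not at hc
    obtain ⟨b, hb, hne⟩ := hc
    rw [Finset.prod_eq_zero (i := b) (Finset.mem_univ _), mul_zero]
    rw [if_neg hb, Matrix.one_apply_ne hne]

theorem embed_add {A B : Finset ℤ} (h : A ⊆ B) (X Y : Op d A) :
    embed h (X + Y) = embed h X + embed h Y := by
  ext σ σ'
  simp only [embed, Matrix.of_apply, Matrix.add_apply]
  split_ifs <;> simp

theorem embed_smul {A B : Finset ℤ} (h : A ⊆ B) (c : ℂ) (X : Op d A) :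
    embed h (c • X) = c • embed h X := by
  ext σ σ'
  simp only [embed, Matrix.of_apply, Matrix.smul_apply]
  split_ifs <;> simp

theorem embed_zero {A B : Finset ℤ} (h : A ⊆ B) : embed h (0 : Op d A) = 0 := by
  simpa using embed_smul h 0 (0 : Op d A)

theorem sum_tracelessPart (X : Matrix (Fin d) (Fin d) ℂ) :
    ∑ i, ∑ j, X i j • tracelessPart (Matrix.single i j (1 : ℂ)) = tracelessPart X := by
  have hX : ∑ i, ∑ j, X i j • Matrix.single i j (1 : ℂ) = X := by
    conv_rhs => rw [Matrix.matrix_eq_sum_single X]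
    simp [Matrix.smul_single]
  have ht : ∑ i, ∑ j, X i j * (Matrix.single i j (1 : ℂ)).trace = X.trace := by
    conv_rhs => rw [← hX]
    simp only [Matrix.trace_sum, Matrix.trace_smul, smul_eq_mul]
  simp only [tracelessPart, smul_sub, Finset.sum_sub_distrib, hX, smul_smul, ← Finset.sum_smul]
  rw [← ht]
  simp only [Finset.sum_div, mul_div_assoc]

theorem sum_trace (X : Matrix (Fin d) (Fin d) ℂ) :
    ∑ i, ∑ j, X i j * ((Matrix.single i j (1 : ℂ)).trace / d) = X.trace / d := by
  have hX : ∑ i, ∑ j, X i j • Matrix.single i j (1 : ℂ) = X := by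
    conv_rhs => rw [Matrix.matrix_eq_sum_single X]
    simp [Matrix.smul_single]
  conv_rhs => rw [← hX]
  simp only [Matrix.trace_sum, Matrix.trace_smul, Finset.sum_div, smul_eq_mul, mul_div_assoc]

theorem span_prodOp (A : Finset ℤ) : Submodule.span ℂ (Set.range (prodOp (d := d) (A := A))) =
    ⊤ := by
  rw [eq_top_iff]
  intro Y _
  rw [Matrix.matrix_eq_sum_single Y]
  refine Submodule.sum_mem _ fun σ _ => Submodule.sum_mem _ fun σ' _ => ?_
  have : Matrix.single σ σ' (Y σ σ') =
      Y σ σ' • prodOp fun a => Matrix.single (σ a) (σ' a) (1 : ℂ) := by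
    ext s s'
    simp only [prodOp, Matrix.single_apply, Matrix.smul_apply, Matrix.of_apply, smul_eq_mul,
      Finset.prod_ite_zero, Finset.prod_const_one, mul_ite, mul_one, mul_zero, funext_iff,
      Finset.mem_univ, true_imp_iff, forall_and]
  rw [this]
  exact Submodule.smul_mem _ _ (Submodule.subset_span ⟨_, rfl⟩)

variable [NeZero d]

theorem component_add {A B : Finset ℤ} (h : A ⊆ B) (Y Z : Op d B) :
    component h (Y + Z) = component h Y + component h Z := by
  simp only [component, Matrix.add_apply, add_mul, add_smul, Finset.sum_add_distrib]

theorem component_smul {A B : Finset ℤ} (h : A ⊆ B) (c : ℂ) (Y : Op d B) :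
    component h (c • Y) = c • component h Y := by
  simp only [component, Matrix.smul_apply, smul_eq_mul, mul_assoc, Finset.smul_sum, mul_smul]

/-- `component` on product operators. -/
theorem component_prodOp {A B : Finset ℤ} (h : A ⊆ B) (X : B → Matrix (Fin d) (Fin d) ℂ) :
    (component h (prodOp X) : Op d A) = (∏ b : B, if b.1 ∈ A then 1 else (X b).trace / d) •
      prodOp fun a : A => tracelessPart (X ⟨a.1, h a.2⟩) := by
  ext s s'
  have split : ∀ f : B → ℂ, ∀ g : A → ℂ,
      (∏ b : B, if b.1 ∈ A then 1 else f b) * ∏ a : A, g a =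
        ∏ b : B, if hb : b.1 ∈ A then g ⟨b.1, hb⟩ else f b := by
    intro f g
    have : (∏ a : A, g a) = ∏ b : B, (if hb : b.1 ∈ A then g ⟨b.1, hb⟩ else 1) := by
      refine Finset.prod_of_injOn (fun a : A => (⟨a.1, h a.2⟩ : B)) ?_ ?_ ?_ ?_
      · intro a _ b _ hab; exact Subtype.ext (congrArg (fun b : B => b.1) hab)
      · intro a _; simp
      · intro b _ hb
        rw [dif_neg]
        intro hbA
        exact hb ⟨⟨b.1, hbA⟩, by simp, rfl⟩
      · intro a _; simp
    rw [this, ← Finset.prod_mul_distrib]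
    refine Finset.prod_congr rfl fun b _ => ?_
    split_ifs <;> simp
  simp only [component, prodOp, Submodule.coe_sum, Submodule.coe_smul, Matrix.sum_apply,
    Matrix.smul_apply, Matrix.of_apply, smul_eq_mul, mul_assoc]
  simp only [split, ← Finset.prod_mul_distrib]
  rw [← Finset.sum_product' (f := fun σ σ' : B → Fin d => ∏ b : B, X b (σ b) (σ' b) *
    if hb : b.1 ∈ A then tracelessPart (Matrix.single (σ b) (σ' b) (1 : ℂ)) (s ⟨b.1, hb⟩)
      (s' ⟨b.1, hb⟩) else (Matrix.single (σ b) (σ' b) (1 : ℂ)).trace / d)]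
  rw [Finset.univ_product_univ, ← (Equiv.arrowProdEquivProdArrow B (fun _ => Fin d)
    (fun _ => Fin d)).sum_comp]
  simp only [Equiv.arrowProdEquivProdArrow, Equiv.coe_fn_mk]
  rw [← Fintype.prod_sum (fun (b : B) (p : Fin d × Fin d) => X b p.1 p.2 *
    if hb : b.1 ∈ A then tracelessPart (Matrix.single p.1 p.2 (1 : ℂ)) (s ⟨b.1, hb⟩)
      (s' ⟨b.1, hb⟩) else (Matrix.single p.1 p.2 (1 : ℂ)).trace / d)]
  refine Finset.prod_congr rfl fun b _ => ?_
  rw [Fintype.sum_prod_type]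
  split_ifs with hb
  · rw [← sum_tracelessPart (X b)]
    simp only [Matrix.sum_apply, Matrix.smul_apply, smul_eq_mul]
  · exact sum_trace (X b)

/-- `component` inverts the embedding on traceless operators. -/
theorem component_embed_self {A B : Finset ℤ} (h : A ⊆ B) (X : tracelessOps d A) :
    component h (embed h (X : Op d A)) = X := by
  have hd : (d : ℂ) ≠ 0 := Nat.cast_ne_zero.2 (NeZero.ne d)
  obtain ⟨X, hX⟩ := X
  refine Subtype.ext ?_
  change (component h (embed h X) : Op d A) = X
  induction hX using Submodule.span_induction with
  | mem Y hY =>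
    obtain ⟨X, hX, rfl⟩ := hY
    rw [embed_prodOp, component_prodOp]
    have e : ∀ a, tracelessPart (X a) = X a := fun a => by simp [tracelessPart, hX]
    rw [Finset.prod_eq_one, one_smul]
    · congr 1; ext1 a; simp [e]
    · intro b _
      split_ifs with hb <;> simp [hd]
  | zero => rw [embed_zero]; simpa using congrArg Subtype.val (component_smul h 0 (0 : Op d B))
  | add X Y _ _ hX hY => rw [embed_add, component_add, Submodule.coe_add, hX, hY]
  | smul c X _ hX => rw [embed_smul, component_smul, Submodule.coe_smul, hX]

theorem component_sum {A B : Finset ℤ} (h : A ⊆ B) {ι : Type*} (s : Finset ι) (Y : ι → Op d B) :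
    component h (∑ i ∈ s, Y i) = ∑ i ∈ s, component h (Y i) :=
  map_sum (AddMonoidHom.mk' (component h) (component_add h)) Y s

/-- The components of commutators of embedded traceless operators vanish unless the supports
overlap suitably. -/
theorem component_commutator {A B C C' : Finset ℤ} (h : A ⊆ B) (hC : C ⊆ B) (hC' : C' ⊆ B)
    (X : tracelessOps d C) (Y : tracelessOps d C') (hn : Disjoint C A ∨ ¬ C' ⊆ A ∪ C) :
    component h (embed hC (X : Op d C) * embed hC' (Y : Op d C')) =
      component h (embed hC' (Y : Op d C') * embed hC (X : Op d C)) := by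
  obtain ⟨X, hX⟩ := X
  obtain ⟨Y, hY⟩ := Y
  change component h (embed hC X * embed hC' Y) = component h (embed hC' Y * embed hC X)
  induction hX, hY using Submodule.span_induction₂ with
  | mem_mem X Y hX hY =>
    obtain ⟨X, hX, rfl⟩ := hX
    obtain ⟨Y, hY, rfl⟩ := hY
    refine Subtype.ext ?_
    simp only [embed_prodOp, prodOp_mul, component_prodOp]
    rcases hn with hn | hn
    · congr 1
      · refine Finset.prod_congr rfl fun b _ => ?_
        rw [Matrix.trace_mul_comm]
      · congr 1; ext1 a
        have : a.1 ∉ C := fun hc => Finset.disjoint_left.1 hn hc a.2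
        simp [this]
    · obtain ⟨b, hb, hbn⟩ := Finset.not_subset.1 hn
      simp only [Finset.mem_union, not_or] at hbn
      rw [Finset.prod_eq_zero (i := ⟨b, hC' hb⟩) (Finset.mem_univ _), zero_smul,
        Finset.prod_eq_zero (i := ⟨b, hC' hb⟩) (Finset.mem_univ _), zero_smul]
      all_goals simp [hbn, hb, hY]
  | zero_left => simp [embed_zero]
  | zero_right => simp [embed_zero]
  | add_left X X' Y _ _ _ h₁ h₂ => simp only [embed_add, add_mul, mul_add, component_add, h₁, h₂]
  | add_right X Y Y' _ _ _ h₁ h₂ => simp only [embed_add, add_mul, mul_add, component_add, h₁, h₂]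
  | smul_left c X Y _ _ h₁ =>
    simp only [embed_smul, smul_mul_assoc, mul_smul_comm, component_smul, h₁]
  | smul_right c X Y _ _ h₁ =>
    simp only [embed_smul, smul_mul_assoc, mul_smul_comm, component_smul, h₁]

/-- The components of products do not depend on the surrounding region. -/
theorem component_mul_indep {A B B' C C' : Finset ℤ} (h : A ⊆ B) (hB : B ⊆ B') (hC : C ⊆ B)
    (hC' : C' ⊆ B) (X : Op d C) (Y : Op d C') :
    component (h.trans hB) (embed (hC.trans hB) X * embed (hC'.trans hB) Y) =
      component h (embed hC X * embed hC' Y) := by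
  have hd : (d : ℂ) ≠ 0 := Nat.cast_ne_zero.2 (NeZero.ne d)
  have hX : X ∈ Submodule.span ℂ (Set.range (prodOp (d := d) (A := C))) := by
    rw [span_prodOp]; trivial
  have hY : Y ∈ Submodule.span ℂ (Set.range (prodOp (d := d) (A := C'))) := by
    rw [span_prodOp]; trivial
  induction hX, hY using Submodule.span_induction₂ with
  | mem_mem X Y hX hY =>
    obtain ⟨X, rfl⟩ := hX
    obtain ⟨Y, rfl⟩ := hY
    refine Subtype.ext ?_
    simp only [embed_prodOp, prodOp_mul, component_prodOp]
    congr 1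
    symm
    refine Finset.prod_of_injOn (fun b : B => (⟨b.1, hB b.2⟩ : B')) ?_ ?_ ?_ ?_
    · intro a _ b _ hab; exact Subtype.ext (congrArg (fun b : B' => b.1) hab)
    · intro a _; simp
    · intro b _ hb
      have hbB : b.1 ∉ B := fun hbB => hb ⟨⟨b.1, hbB⟩, by simp, rfl⟩
      have h₁ : b.1 ∉ C := fun hc => hbB (hC hc)
      have h₂ : b.1 ∉ C' := fun hc => hbB (hC' hc)
      simp [h₁, h₂, hd]
    · intro a _; simp
  | zero_left =>
    have z : ∀ {B : Finset ℤ} (h : A ⊆ B), component h (0 : Op d B) = 0 := fun h => by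
      simpa using component_smul h 0 (0 : Op d _)
    simp [embed_zero, z]
  | zero_right =>
    have z : ∀ {B : Finset ℤ} (h : A ⊆ B), component h (0 : Op d B) = 0 := fun h => by
      simpa using component_smul h 0 (0 : Op d _)
    simp [embed_zero, z]
  | add_left X X' Y _ _ _ h₁ h₂ => simp only [embed_add, add_mul, component_add, h₁, h₂]
  | add_right X Y Y' _ _ _ h₁ h₂ => simp only [embed_add, mul_add, component_add, h₁, h₂]
  | smul_left c X Y _ _ h₁ =>
    simp only [embed_smul, smul_mul_assoc, component_smul, h₁]
  | smul_right c X Y _ _ h₁ =>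
    simp only [embed_smul, mul_smul_comm, component_smul, h₁]

theorem component_sub {A B : Finset ℤ} (h : A ⊆ B) (Y Z : Op d B) :
    component h (Y - Z) = component h Y - component h Z :=
  map_sub (AddMonoidHom.mk' (component h) (component_add h)) Y Z

theorem component_restrict {A B : Finset ℤ} (h : A ⊆ B) (Φ Ψ : FormalOp d) :
    component h (restrict Φ B * restrict Ψ B - restrict Ψ B * restrict Φ B) =
      ∑ p ∈ B.powerset ×ˢ B.powerset, if hp : p.1 ⊆ B ∧ p.2 ⊆ B then
        component h (embed hp.1 (Φ p.1 : Op d p.1) * embed hp.2 (Ψ p.2 : Op d p.2)) -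
        component h (embed hp.2 (Ψ p.2 : Op d p.2) * embed hp.1 (Φ p.1 : Op d p.1)) else 0 := by
  simp only [restrict]
  rw [Finset.sum_mul_sum, Finset.sum_mul_sum, Finset.sum_comm (γ := {A // A ∈ B.powerset}),
    ← Finset.sum_sub_distrib, Finset.sum_product_right, component_sum, ← Finset.sum_coe_sort B.powerset]
  refine Finset.sum_congr rfl fun C' _ => ?_
  rw [← Finset.sum_sub_distrib, component_sum, ← Finset.sum_coe_sort B.powerset]
  refine Finset.sum_congr rfl fun C _ => ?_
  rw [dif_pos ⟨Finset.mem_powerset.1 C.2, Finset.mem_powerset.1 C'.2⟩, component_sub]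

theorem exists_isCommAt {n : ℕ} {Φ : FormalOp d} (hΦ : AtMostLocal n Φ) (Ψ : FormalOp d)
    (A : Finset ℤ) : ∃ Z, IsCommAt Φ Ψ A Z := by
  set U : Finset ℤ := A ∪ A.biUnion fun a => Finset.Icc (a - n) (a + n) with hU
  have hAU : A ⊆ U := Finset.subset_union_left
  refine ⟨component hAU (restrict Φ U * restrict Ψ U - restrict Ψ U * restrict Φ U), U,
    fun B hB h => ?_⟩
  rw [component_restrict, component_restrict]
  symm
  refine Finset.sum_subset_zero_on_sdiff
    (Finset.product_subset_product (Finset.powerset_mono.2 hB) (Finset.powerset_mono.2 hB)) ?_ ?_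
  · intro p hp
    split_ifs with hpB
    · rw [sub_eq_zero]
      by_cases hz : Φ p.1 = 0
      · simp [hz, embed_zero]
      have hr := hΦ _ hz
      refine component_commutator h hpB.1 hpB.2 (Φ p.1) (Ψ p.2) ?_
      by_contra! hcon
      obtain ⟨hd, hsub⟩ := hcon
      obtain ⟨a, haC, haA⟩ := Finset.not_disjoint_iff.1 hd
      have hCU : p.1 ⊆ U := by
        intro c hc
        rw [setRange, dif_pos ⟨a, haC⟩] at hr
        have h1 := Finset.le_max' _ a haC
        have h2 := Finset.min'_le _ a haC
        have h3 := Finset.le_max' _ c hc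
        have h4 := Finset.min'_le _ c hc
        refine Finset.mem_union_right _ (Finset.mem_biUnion.2 ⟨a, haA, Finset.mem_Icc.2 ?_⟩)
        omega
      refine (Finset.mem_sdiff.1 hp).2 (Finset.mem_product.2
        ⟨Finset.mem_powerset.2 hCU, Finset.mem_powerset.2 (hsub.trans ?_)⟩)
      exact Finset.union_subset hAU hCU
    · rfl
  · intro p hp
    obtain ⟨h1, h2⟩ := Finset.mem_product.1 hp
    have h1 := Finset.mem_powerset.1 h1
    have h2 := Finset.mem_powerset.1 h2
    rw [dif_pos ⟨h1, h2⟩, dif_pos ⟨h1.trans hB, h2.trans hB⟩,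
      component_mul_indep hAU hB h1 h2, component_mul_indep hAU hB h2 h1]

theorem IsCommAt.unique {Φ Ψ : FormalOp d} {A : Finset ℤ} {Z Z' : tracelessOps d A}
    (hZ : IsCommAt Φ Ψ A Z) (hZ' : IsCommAt Φ Ψ A Z') : Z = Z' := by
  obtain ⟨B, hB⟩ := hZ
  obtain ⟨B', hB'⟩ := hZ'
  have h : A ⊆ A ∪ (B ∪ B') := Finset.subset_union_left
  have h1 : B ⊆ A ∪ (B ∪ B') := Finset.subset_union_left.trans Finset.subset_union_right
  have h2 : B' ⊆ A ∪ (B ∪ B') := Finset.subset_union_right.trans Finset.subset_union_right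
  rw [← hB _ h1 h, ← hB' _ h2 h]

/-- For local `Φ` the commutator is well defined. -/
theorem isCommAt_comm {n : ℕ} {Φ : FormalOp d} (hΦ : AtMostLocal n Φ) (Ψ : FormalOp d)
    (A : Finset ℤ) : IsCommAt Φ Ψ A (comm Φ Ψ A) := by
  have h := exists_isCommAt hΦ Ψ A
  rw [comm, dif_pos h]
  exact h.choose_spec

end WellDefined

/-- The translate `A + x` of a set of sites. -/
def shiftSet (A : Finset ℤ) (x : ℤ) : Finset ℤ := A.map (addRightEmbedding x)

/-- The translate to `A + x` of an operator on `A`. -/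
def shiftOp {d : ℕ} {A : Finset ℤ} (x : ℤ) (X : Op d A) : Op d (shiftSet A x) :=
  X.submatrix (fun σ a => σ ⟨a.1 + x, Finset.mem_map_of_mem (addRightEmbedding x) a.2⟩)
    (fun σ a => σ ⟨a.1 + x, Finset.mem_map_of_mem (addRightEmbedding x) a.2⟩)

def IsTranslationInvariant {d : ℕ} (Φ : FormalOp d) : Prop :=
  ∀ (A : Finset ℤ) (x : ℤ), (Φ (shiftSet A x) : Op d (shiftSet A x)) = shiftOp x (Φ A : Op d A)

def IsHermitian {d : ℕ} (Φ : FormalOp d) : Prop :=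
  ∀ A, (Φ A : Op d A).IsHermitian

/-- The formal sum `∑_{j ∈ ℤ} Φ_j`, for families such that for each `A` only finitely many of the
`Φ_j(A)` are nonzero. -/
noncomputable def formalSum {d : ℕ} (Φ : ℤ → FormalOp d) : FormalOp d := fun A => ∑ᶠ j, Φ j A

/-- `h⁽²⁾_j + h⁽¹⁾_j`, the terms of the Hamiltonian attached to the site `j`. -/
noncomputable def siteTerm {d : ℕ} (h2 : (j : ℤ) → tracelessOps d {j, j + 1})
    (h1 : (j : ℤ) → tracelessOps d {j}) (j : ℤ) : FormalOp d :=
  Pi.single {j, j + 1} (h2 j) + Pi.single {j} (h1 j)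

/-- The Hamiltonian `H = ∑_j (h⁽²⁾_j + h⁽¹⁾_j)`. -/
noncomputable def hamiltonian {d : ℕ} (h2 : (j : ℤ) → tracelessOps d {j, j + 1})
    (h1 : (j : ℤ) → tracelessOps d {j}) : FormalOp d :=
  formalSum (siteTerm h2 h1)

/-- The boost operator `∑_j j (h⁽²⁾_j + h⁽¹⁾_j) + C`. -/
noncomputable def boost {d : ℕ} (h2 : (j : ℤ) → tracelessOps d {j, j + 1})
    (h1 : (j : ℤ) → tracelessOps d {j}) (C : FormalOp d) : FormalOp d :=
  formalSum (fun j => (j : ℂ) • siteTerm h2 h1 j) + C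

/-- `Q⁽²⁾ = H` and `Q⁽ⁿ⁺¹⁾ = [B, Q⁽ⁿ⁾]` for `n ≥ 2`; the values at `0` and `1` are not used. -/
noncomputable def charge {d : ℕ} [NeZero d] (H B : FormalOp d) : ℕ → FormalOp d
  | 0 => 0
  | 1 => 0
  | 2 => H
  | n + 3 => comm B (charge H B (n + 2))

end SpinChain

/-! Write `Qₙ` for `Q⁽ⁿ⁾` and `B` for the boost. If `[H, Qₙ] = 0`, the Jacobi identity gives `[Q₃,
Qₙ] = [[B, H], Qₙ] = -[H, Qₙ₊₁]`. Since `H` commutes with `Q₃` and with `Qₙ`, it commutes with `[Q₃,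
Qₙ]`, so `[H, [H, Qₙ₊₁]] = 0`. The crux is that `ad H` is semisimple on translation-invariant local
operators (`comm_eq_zero_of_comm_comm_eq_zero`): for the inner product given by the trace per site,
`ad H` with Hermitian `H` is symmetric, so the norm of `[H, Φ]` is the pairing of `Φ` with `[H, [H,
Φ]]`. Hence `[H, Qₙ₊₁] = 0`.

Translation invariance passes from `Qₙ` to `Qₙ₊₁` because a translation changes `B` only by a
multiple of `H`, which commutes with `Qₙ` (`isTranslationInvariant_comm`). Locality grows by one
site per commutator with `B` (`AtMostLocal.comm`). Finally `[Qₘ₊₁, Qₙ] = [B, [Qₘ, Qₙ]] - [Qₘ, Qₙ₊₁]`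
gives mutual commutation by induction on `m` (`comm_charge_charge`).

Infinite sums are handled by duality. A formal operator `Φ` is encoded faithfully by the functional
`X ↦ tr(Φ X)` on the algebra of finitely supported operators (`pairing`), and a local `Φ` also by
the derivation `X ↦ [Φ, X]` of that algebra (`IsAd`). The functional of `[Φ, Ψ]` is minus that of
`Ψ` composed with the derivation of `Φ` (`pairing_comm`), so the Jacobi identity and equivariance
become algebra of derivations. -/

namespace SpinChain

/-! ### Functionals on a tracial algebra and the derivations they induce -/

section Tracial

variable {𝒜 : Type*} [Ring 𝒜] [Algebra ℂ 𝒜]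

/-- `δ` plays the role of the commutator with the (possibly infinite) operator whose pairing with
the algebra under the trace is `φ`. -/
def IsAd (tr φ : 𝒜 →ₗ[ℂ] ℂ) (δ : 𝒜 →ₗ[ℂ] 𝒜) : Prop :=
  ∀ X Y, tr (Y * δ X) = φ (X * Y - Y * X)

variable {tr : 𝒜 →ₗ[ℂ] ℂ}

/-- A pointwise choice of values is automatically linear, because nondegeneracy of the trace makes
each value unique. -/
theorem exists_isAd (hnd : ∀ Z, (∀ Y, tr (Y * Z) = 0) → Z = 0) {φ : 𝒜 →ₗ[ℂ] ℂ}
    (h : ∀ X, ∃ Z, ∀ Y, tr (Y * Z) = φ (X * Y - Y * X)) : ∃ δ, IsAd tr φ δ := by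
  choose δ hδ using h
  refine ⟨⟨⟨δ, fun X X' => ?_⟩, fun c X => ?_⟩, hδ⟩
  · rw [← sub_eq_zero]
    refine hnd _ fun Y => ?_
    rw [mul_sub, map_sub, mul_add, map_add, hδ, hδ, hδ, ← map_add, ← map_sub]
    convert map_zero φ using 2
    noncomm_ring
  · rw [← sub_eq_zero]
    refine hnd _ fun Y => ?_
    simp only [RingHom.id_apply, mul_sub, map_sub, mul_smul_comm, map_smul, hδ, smul_mul_assoc,
      smul_sub, sub_self]

variable {φ ψ : 𝒜 →ₗ[ℂ] ℂ} {δ ε : 𝒜 →ₗ[ℂ] 𝒜}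

theorem IsAd.trace_mul (hδ : IsAd tr φ δ) (X Y : 𝒜) : tr (Y * δ X) = -tr (X * δ Y) := by
  rw [hδ, hδ, ← map_neg, neg_sub]

theorem IsAd.leibniz (hnd : ∀ Z, (∀ Y, tr (Y * Z) = 0) → Z = 0)
    (hcomm : ∀ X Y, tr (X * Y) = tr (Y * X)) (hδ : IsAd tr φ δ) (X Y : 𝒜) :
    δ (X * Y) = δ X * Y + X * δ Y := by
  rw [← sub_eq_zero]
  refine hnd _ fun Z => ?_
  rw [mul_sub, mul_add, map_sub, map_add, hδ, ← mul_assoc Z (δ X), hcomm (Z * δ X) Y,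
    ← mul_assoc Y, hδ, ← mul_assoc Z X (δ Y), hδ, ← map_add, ← map_sub]
  convert map_zero φ using 2
  noncomm_ring

/-- The derivation of a commutator is the commutator of the derivations. -/
theorem IsAd.bracket (hnd : ∀ Z, (∀ Y, tr (Y * Z) = 0) → Z = 0)
    (hcomm : ∀ X Y, tr (X * Y) = tr (Y * X)) (hδ : IsAd tr φ δ) (hε : IsAd tr ψ ε) :
    IsAd tr (-(ψ ∘ₗ δ)) (δ ∘ₗ ε - ε ∘ₗ δ) := by
  intro X Y
  -- Only one of the two derivations is moved onto `Y`, so that both terms end up as values of `ψ`;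
  -- the Leibniz rule for `δ` then matches them.
  have h1 : tr (Y * δ (ε X)) = -ψ (X * δ Y - δ Y * X) := by
    rw [hδ.trace_mul, hcomm, hε]
  have h2 : tr (Y * ε (δ X)) = ψ (δ X * Y - Y * δ X) := hε _ _
  simp only [LinearMap.sub_apply, LinearMap.comp_apply, LinearMap.neg_apply, mul_sub, map_sub, h1,
    h2, hδ.leibniz hnd hcomm, map_add]
  ring

/-- Derivations are equivariant under trace-preserving surjective endomorphisms. -/
theorem IsAd.map_comp (hnd : ∀ Z, (∀ Y, tr (Y * Z) = 0) → Z = 0) {τ : 𝒜 →ₐ[ℂ] 𝒜}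
    (hτ : Function.Surjective τ) (htr : ∀ X, tr (τ X) = tr X)
    (hδ : IsAd tr φ δ) (hε : IsAd tr (φ ∘ₗ τ.toLinearMap) ε) (X : 𝒜) : τ (ε X) = δ (τ X) := by
  rw [← sub_eq_zero]
  refine hnd _ fun Y => ?_
  obtain ⟨Y, rfl⟩ := hτ Y
  rw [mul_sub, map_sub, ← map_mul, htr, hε, hδ, sub_eq_zero]
  simp

end Tracial

/-! ### Product operators -/

section FiniteRegions

variable {d : ℕ}

/-- The product over the sites of `A` of a family of one-site operators on the whole chain. -/
def chainOp (A : Finset ℤ) (X : ℤ → Matrix (Fin d) (Fin d) ℂ) : Op d A := prodOp fun a => X a.1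

theorem chainOp_congr {A : Finset ℤ} {X Y : ℤ → Matrix (Fin d) (Fin d) ℂ}
    (h : ∀ a ∈ A, X a = Y a) : chainOp A X = chainOp A Y := by
  simp only [chainOp]
  congr 1
  ext1 a
  exact h a.1 a.2

theorem prodOp_eq_chainOp {A : Finset ℤ} (X : A → Matrix (Fin d) (Fin d) ℂ) :
    prodOp X = chainOp A fun a => if h : a ∈ A then X ⟨a, h⟩ else 0 := by
  simp [chainOp]

/-- Product operators span, so linear identities need only be checked site by site. Indexing the
factors by all of `ℤ` lets embeddings and translations act on the family itself. -/
theorem op_induction {A : Finset ℤ} {p : Op d A → Prop} (X : Op d A)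
    (hprod : ∀ X, p (chainOp A X)) (hadd : ∀ X Y, p X → p Y → p (X + Y))
    (hsmul : ∀ (c : ℂ) X, p X → p (c • X)) : p X := by
  have hX : X ∈ Submodule.span ℂ (Set.range (prodOp (d := d) (A := A))) := by
    rw [span_prodOp]; trivial
  induction hX using Submodule.span_induction with
  | mem Y hY => obtain ⟨Y, rfl⟩ := hY; rw [prodOp_eq_chainOp]; exact hprod _
  | zero => simpa using hsmul 0 _ (hprod 0)
  | add X Y _ _ hX hY => exact hadd _ _ hX hY
  | smul c X _ hX => exact hsmul _ _ hX

theorem chainOp_mem {A : Finset ℤ} {X : ℤ → Matrix (Fin d) (Fin d) ℂ}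
    (hX : ∀ a ∈ A, (X a).trace = 0) : chainOp A X ∈ tracelessOps d A :=
  Submodule.subset_span ⟨_, fun a => hX a.1 a.2, rfl⟩

theorem traceless_induction {A : Finset ℤ} {p : (X : Op d A) → X ∈ tracelessOps d A → Prop}
    {X : Op d A} (hX : X ∈ tracelessOps d A)
    (hprod : ∀ (X : ℤ → Matrix (Fin d) (Fin d) ℂ) (hX : ∀ a, (X a).trace = 0),
      p (chainOp A X) (chainOp_mem fun a _ => hX a))
    (hadd : ∀ X Y hX hY, p X hX → p Y hY → p (X + Y) (add_mem hX hY))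
    (hsmul : ∀ (c : ℂ) X hX, p X hX → p (c • X) (Submodule.smul_mem _ c hX)) : p X hX := by
  induction hX using Submodule.span_induction with
  | mem Y hY =>
    obtain ⟨Y, hY, rfl⟩ := hY
    simp only [prodOp_eq_chainOp]
    refine hprod _ fun a => ?_
    split_ifs <;> simp [hY]
  | zero => simpa using hsmul 0 _ _ (hprod 0 (by simp))
  | add X Y hX hY h h' => exact hadd _ _ hX hY h h'
  | smul c X hX h => exact hsmul _ _ hX h

theorem chainOp_mul {A : Finset ℤ} (X Y : ℤ → Matrix (Fin d) (Fin d) ℂ) :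
    chainOp A X * chainOp A Y = chainOp A fun a => X a * Y a := prodOp_mul _ _

theorem chainOp_one (A : Finset ℤ) : chainOp A (fun _ => 1) = (1 : Op d A) := by
  ext σ σ'
  simp [chainOp, prodOp, Matrix.one_apply, Finset.prod_ite_zero, funext_iff]

theorem embed_chainOp {A B : Finset ℤ} (h : A ⊆ B) (X : ℤ → Matrix (Fin d) (Fin d) ℂ) :
    embed h (chainOp A X) = chainOp B fun b => if b ∈ A then X b else 1 := by
  rw [chainOp, embed_prodOp]; simp [chainOp]

theorem embed_mul {A B : Finset ℤ} (h : A ⊆ B) (X Y : Op d A) :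
    embed h (X * Y) = embed h X * embed h Y := by
  induction X using op_induction with
  | hprod X =>
    induction Y using op_induction with
    | hprod Y =>
      rw [chainOp_mul, embed_chainOp, embed_chainOp, embed_chainOp, chainOp_mul]
      refine chainOp_congr fun a _ => ?_
      split_ifs <;> simp
    | hadd Y Z hY hZ => simp only [mul_add, embed_add, hY, hZ]
    | hsmul c Y hY => simp only [mul_smul_comm, embed_smul, hY]
  | hadd X Z hX hZ => simp only [add_mul, embed_add, hX, hZ]
  | hsmul c Y hY => simp only [smul_mul_assoc, embed_smul, hY]

theorem embed_one {A B : Finset ℤ} (h : A ⊆ B) : embed h (1 : Op d A) = 1 := by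
  rw [← chainOp_one, embed_chainOp, ← chainOp_one]
  exact chainOp_congr fun a _ => by simp

theorem embed_embed {A B C : Finset ℤ} (h : A ⊆ B) (h' : B ⊆ C) (X : Op d A) :
    embed h' (embed h X) = embed (h.trans h') X := by
  induction X using op_induction with
  | hprod X =>
    rw [embed_chainOp, embed_chainOp, embed_chainOp]
    refine chainOp_congr fun a _ => ?_
    by_cases ha : a ∈ A
    · simp [ha, h ha]
    · simp [ha]
  | hadd Y Z hY hZ => simp only [embed_add, hY, hZ]
  | hsmul c Y hY => simp only [embed_smul, hY]

theorem embed_self {A : Finset ℤ} (h : A ⊆ A) (X : Op d A) : embed h X = X := by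
  induction X using op_induction with
  | hprod X => rw [embed_chainOp]; exact chainOp_congr fun a ha => by simp [ha]
  | hadd Y Z hY hZ => simp only [embed_add, hY, hZ]
  | hsmul c Y hY => simp only [embed_smul, hY]

/-- The embedding of the operators on `A` into the operators on `B`, as a homomorphism. -/
def embedHom (A B : Finset ℤ) (h : A ≤ B) : Op d A →ₐ[ℂ] Op d B where
  toFun := embed h
  map_one' := embed_one h
  map_mul' := embed_mul h
  map_zero' := embed_zero h
  map_add' := embed_add h
  commutes' c := by rw [Algebra.algebraMap_eq_smul_one, Algebra.algebraMap_eq_smul_one, embed_smul,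
    embed_one]

/-- Operators with disjoint supports commute. -/
theorem embed_mul_comm {A B C : Finset ℤ} (hA : A ⊆ B) (hC : C ⊆ B) (hd : Disjoint A C)
    (X : Op d A) (Y : Op d C) : embed hA X * embed hC Y = embed hC Y * embed hA X := by
  induction X using op_induction with
  | hprod X =>
    induction Y using op_induction with
    | hprod Y =>
      rw [embed_chainOp, embed_chainOp, chainOp_mul, chainOp_mul]
      refine chainOp_congr fun a _ => ?_
      by_cases ha : a ∈ A
      · simp [ha, Finset.disjoint_left.1 hd ha]
      · simp [ha]
    | hadd Y Z hY hZ => simp only [embed_add, mul_add, add_mul, hY, hZ]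
    | hsmul c Y hY => simp only [embed_smul, mul_smul_comm, smul_mul_assoc, hY]
  | hadd Y Z hY hZ => simp only [embed_add, mul_add, add_mul, hY, hZ]
  | hsmul c Y hY => simp only [embed_smul, mul_smul_comm, smul_mul_assoc, hY]

/-- The normalized trace. -/
noncomputable def normTrace (A : Finset ℤ) : Op d A →ₗ[ℂ] ℂ :=
  ((d : ℂ) ^ A.card)⁻¹ • Matrix.traceLinearMap (A → Fin d) ℂ ℂ

theorem normTrace_apply {A : Finset ℤ} (X : Op d A) :
    normTrace A X = ((d : ℂ) ^ A.card)⁻¹ * X.trace := rfl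

theorem normTrace_chainOp {A : Finset ℤ} (X : ℤ → Matrix (Fin d) (Fin d) ℂ) :
    normTrace A (chainOp A X) = ∏ a ∈ A, (X a).trace / d := by
  rw [normTrace_apply, Finset.prod_div_distrib, Finset.prod_const, div_eq_inv_mul]
  congr 1
  rw [← Finset.prod_coe_sort]
  simp only [Matrix.trace, Matrix.diag, chainOp, prodOp, Matrix.of_apply]
  rw [Finset.prod_univ_sum, Fintype.piFinset_univ]

theorem normTrace_mul_comm {A : Finset ℤ} (X Y : Op d A) :
    normTrace A (X * Y) = normTrace A (Y * X) := by
  rw [normTrace_apply, Matrix.trace_mul_comm, normTrace_apply]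

/-- The trace factorizes over sites, and a site of `A` outside `C` contributes the trace of a
traceless factor. This orthogonality is what makes pairings with infinite sums finite. -/
theorem normTrace_mul_embed_eq_zero {A B C : Finset ℤ} (hA : A ⊆ B) (hC : C ⊆ B) (hAC : ¬ A ⊆ C)
    {X : Op d A} (hX : X ∈ tracelessOps d A) (Y : Op d C) :
    normTrace B (embed hA X * embed hC Y) = 0 := by
  obtain ⟨b, hb, hbC⟩ := Finset.not_subset.1 hAC
  induction hX using traceless_induction with
  | hprod X hX =>
    induction Y using op_induction with
    | hprod Y =>
      rw [embed_chainOp, embed_chainOp, chainOp_mul, normTrace_chainOp]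
      exact Finset.prod_eq_zero (hA hb) (by simp [hb, hbC, hX])
    | hadd Y Z hY hZ => simp only [embed_add, mul_add, map_add, hY, hZ, add_zero]
    | hsmul c Y hY => simp only [embed_smul, mul_smul_comm, map_smul, hY, smul_zero]
  | hadd Y Z _ _ hY hZ => simp only [embed_add, add_mul, map_add, hY, hZ, add_zero]
  | hsmul c Y _ hY => simp only [embed_smul, smul_mul_assoc, map_smul, hY, smul_zero]

theorem conjTranspose_chainOp {A : Finset ℤ} (X : ℤ → Matrix (Fin d) (Fin d) ℂ) :
    (chainOp A X).conjTranspose = chainOp A fun a => (X a).conjTranspose := by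
  ext σ σ'
  simp [chainOp, prodOp, Matrix.conjTranspose_apply]

theorem conjTranspose_mem {A : Finset ℤ} {X : Op d A} (hX : X ∈ tracelessOps d A) :
    X.conjTranspose ∈ tracelessOps d A := by
  induction hX using traceless_induction with
  | hprod X hX =>
    rw [conjTranspose_chainOp]
    exact chainOp_mem fun a _ => by rw [Matrix.trace_conjTranspose, hX, star_zero]
  | hadd Y Z _ _ hY hZ => rw [Matrix.conjTranspose_add]; exact add_mem hY hZ
  | hsmul c Y _ hY => rw [Matrix.conjTranspose_smul]; exact Submodule.smul_mem _ _ hY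

theorem embed_conjTranspose {A B : Finset ℤ} (h : A ⊆ B) (X : Op d A) :
    embed h X.conjTranspose = (embed h X).conjTranspose := by
  induction X using op_induction with
  | hprod X =>
    rw [embed_chainOp, conjTranspose_chainOp, conjTranspose_chainOp, embed_chainOp]
    refine chainOp_congr fun a _ => ?_
    split_ifs <;> simp
  | hadd Y Z hY hZ => simp only [embed_add, Matrix.conjTranspose_add, hY, hZ]
  | hsmul c Y hY => simp only [embed_smul, Matrix.conjTranspose_smul, hY]

open scoped ComplexOrder in
theorem normTrace_mul_conjTranspose_nonneg {A : Finset ℤ} (X : Op d A) :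
    0 ≤ normTrace A (X * X.conjTranspose) := by
  rw [normTrace_apply]
  refine mul_nonneg (by positivity) ?_
  exact (Matrix.posSemidef_self_mul_conjTranspose X).trace_nonneg

/-! ### Translations of operators -/

theorem mem_shiftSet {A : Finset ℤ} {x a : ℤ} : a ∈ shiftSet A x ↔ a - x ∈ A := by
  simp only [shiftSet, Finset.mem_map, addRightEmbedding_apply]
  exact ⟨by rintro ⟨b, hb, rfl⟩; simpa using hb, fun h => ⟨a - x, h, by simp⟩⟩

theorem shiftSet_mono {A B : Finset ℤ} (h : A ⊆ B) (x : ℤ) : shiftSet A x ⊆ shiftSet B x :=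
  Finset.map_subset_map.2 h

theorem shiftSet_shiftSet (A : Finset ℤ) (x y : ℤ) :
    shiftSet (shiftSet A x) y = shiftSet A (x + y) := by
  ext a
  rw [mem_shiftSet, mem_shiftSet, mem_shiftSet, sub_sub, add_comm y]

theorem shiftSet_zero (A : Finset ℤ) : shiftSet A 0 = A := by
  ext a; simp [mem_shiftSet]

theorem shiftOp_chainOp {A : Finset ℤ} (x : ℤ) (X : ℤ → Matrix (Fin d) (Fin d) ℂ) :
    shiftOp x (chainOp A X) = chainOp (shiftSet A x) fun a => X (a - x) := by
  ext σ σ'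
  simp only [shiftOp, chainOp, prodOp, Matrix.submatrix_apply, Matrix.of_apply]
  refine Fintype.prod_bijective
    (fun a : A => (⟨a.1 + x, Finset.mem_map_of_mem (addRightEmbedding x) a.2⟩ : shiftSet A x))
    ⟨?_, ?_⟩ _ _ fun a => ?_
  · intro a b h
    exact Subtype.ext (add_right_cancel (congrArg Subtype.val h))
  · intro b
    exact ⟨⟨b.1 - x, mem_shiftSet.1 b.2⟩, by simp⟩
  · simp

theorem shiftOp_add {A : Finset ℤ} (x : ℤ) (X Y : Op d A) :
    shiftOp x (X + Y) = shiftOp x X + shiftOp x Y := rfl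

theorem shiftOp_smul {A : Finset ℤ} (x : ℤ) (c : ℂ) (X : Op d A) :
    shiftOp x (c • X) = c • shiftOp x X := rfl

theorem shiftOp_mul {A : Finset ℤ} (x : ℤ) (X Y : Op d A) :
    shiftOp x (X * Y) = shiftOp x X * shiftOp x Y := by
  induction X using op_induction with
  | hprod X =>
    induction Y using op_induction with
    | hprod Y => simp only [chainOp_mul, shiftOp_chainOp]
    | hadd Y Z hY hZ => simp only [mul_add, shiftOp_add, hY, hZ]
    | hsmul c Y hY => simp only [mul_smul_comm, shiftOp_smul, hY]
  | hadd X Z hX hZ => simp only [add_mul, shiftOp_add, hX, hZ]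
  | hsmul c Y hY => simp only [smul_mul_assoc, shiftOp_smul, hY]

theorem shiftOp_one {A : Finset ℤ} (x : ℤ) : shiftOp x (1 : Op d A) = 1 := by
  rw [← chainOp_one, shiftOp_chainOp, chainOp_one]

theorem shiftOp_embed {A B : Finset ℤ} (h : A ⊆ B) (x : ℤ) (X : Op d A) :
    shiftOp x (embed h X) = embed (shiftSet_mono h x) (shiftOp x X) := by
  induction X using op_induction with
  | hprod X =>
    simp only [embed_chainOp, shiftOp_chainOp, mem_shiftSet]
  | hadd Y Z hY hZ => simp only [embed_add, shiftOp_add, hY, hZ]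
  | hsmul c Y hY => simp only [embed_smul, shiftOp_smul, hY]

theorem normTrace_shiftOp {A : Finset ℤ} (x : ℤ) (X : Op d A) :
    normTrace (shiftSet A x) (shiftOp x X) = normTrace A X := by
  induction X using op_induction with
  | hprod X =>
    simp only [shiftOp_chainOp, normTrace_chainOp]
    simp [shiftSet]
  | hadd Y Z hY hZ => simp only [shiftOp_add, map_add, hY, hZ]
  | hsmul c Y hY => simp only [shiftOp_smul, map_smul, hY]

theorem shiftOp_mem {A : Finset ℤ} (x : ℤ) {X : Op d A} (hX : X ∈ tracelessOps d A) :
    shiftOp x X ∈ tracelessOps d (shiftSet A x) := by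
  induction hX using traceless_induction with
  | hprod X hX => rw [shiftOp_chainOp]; exact chainOp_mem fun a _ => hX _
  | hadd Y Z _ _ hY hZ => exact add_mem hY hZ
  | hsmul c Y _ hY => exact Submodule.smul_mem _ _ hY

theorem shiftOp_surjective {A : Finset ℤ} (x : ℤ) :
    Function.Surjective (shiftOp (d := d) (A := A) x) := by
  intro Y
  induction Y using op_induction with
  | hprod Y => exact ⟨chainOp A fun a => Y (a + x), by simp [shiftOp_chainOp]⟩
  | hadd Y Z hY hZ =>
    obtain ⟨Y, rfl⟩ := hY
    obtain ⟨Z, rfl⟩ := hZ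
    exact ⟨Y + Z, rfl⟩
  | hsmul c Y hY => obtain ⟨Y, rfl⟩ := hY; exact ⟨c • Y, rfl⟩

theorem exists_shiftOp_eq_of_mem {A : Finset ℤ} {x : ℤ} {Y : Op d (shiftSet A x)}
    (hY : Y ∈ tracelessOps d (shiftSet A x)) : ∃ X ∈ tracelessOps d A, shiftOp x X = Y := by
  induction hY using traceless_induction with
  | hprod Y hY =>
    exact ⟨chainOp A fun a => Y (a + x), chainOp_mem fun a _ => hY _, by simp [shiftOp_chainOp]⟩
  | hadd Y Z _ _ hY hZ =>
    obtain ⟨Y, hY, rfl⟩ := hY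
    obtain ⟨Z, hZ, rfl⟩ := hZ
    exact ⟨Y + Z, add_mem hY hZ, rfl⟩
  | hsmul c Y _ hY =>
    obtain ⟨Y, hY, rfl⟩ := hY
    exact ⟨c • Y, Submodule.smul_mem _ c hY, rfl⟩

/-! ### Components -/

theorem conjTranspose_tracelessPart (X : Matrix (Fin d) (Fin d) ℂ) :
    (tracelessPart X).conjTranspose = tracelessPart X.conjTranspose := by
  simp [tracelessPart, Matrix.conjTranspose_sub, Matrix.trace_conjTranspose]

variable [NeZero d]

theorem normTrace_embed {A B : Finset ℤ} (h : A ⊆ B) (X : Op d A) :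
    normTrace B (embed h X) = normTrace A X := by
  have hd : (d : ℂ) ≠ 0 := Nat.cast_ne_zero.2 (NeZero.ne d)
  induction X using op_induction with
  | hprod X =>
    rw [embed_chainOp, normTrace_chainOp, normTrace_chainOp, ← Finset.prod_subset h]
    · exact Finset.prod_congr rfl fun a ha => by simp [ha]
    · intro a _ ha
      simp [ha, hd]
  | hadd Y Z hY hZ => simp only [embed_add, map_add, hY, hZ]
  | hsmul c Y hY => simp only [embed_smul, map_smul, hY]

theorem eq_zero_of_normTrace {A : Finset ℤ} {X : Op d A}
    (h : ∀ Y, normTrace A (Y * X) = 0) : X = 0 := by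
  have hd : (d : ℂ) ≠ 0 := Nat.cast_ne_zero.2 (NeZero.ne d)
  refine Matrix.ext_iff_trace_mul_left.2 fun Y => ?_
  simpa [normTrace_apply, hd] using h Y

open scoped ComplexOrder in
theorem eq_zero_of_normTrace_mul_conjTranspose {A : Finset ℤ} {X : Op d A}
    (h : normTrace A (X * X.conjTranspose) = 0) : X = 0 := by
  have hd : (d : ℂ) ≠ 0 := Nat.cast_ne_zero.2 (NeZero.ne d)
  rw [normTrace_apply, mul_eq_zero] at h
  exact Matrix.trace_mul_conjTranspose_self_eq_zero_iff.1 (h.resolve_left (by simp [hd]))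

theorem component_chainOp {A B : Finset ℤ} (h : A ⊆ B) (X : ℤ → Matrix (Fin d) (Fin d) ℂ) :
    (component h (chainOp B X) : Op d A) =
      (∏ b ∈ B, if b ∈ A then 1 else (X b).trace / d) •
        chainOp A fun a => tracelessPart (X a) := by
  rw [chainOp, component_prodOp, ← Finset.prod_coe_sort B]
  rfl

/-- The components inside `D` of an operator determine its pairing with operators on `D`. -/
theorem sum_normTrace_component {B D : Finset ℤ} (hD : D ⊆ B) (Y : Op d B) (X : Op d D) :
    ∑ A : {A : Finset ℤ // A ∈ D.powerset},
      normTrace D (embed (Finset.mem_powerset.1 A.2)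
        (component ((Finset.mem_powerset.1 A.2).trans hD) Y : Op d A.1) * X) =
      normTrace B (Y * embed hD X) := by
  have hd : (d : ℂ) ≠ 0 := Nat.cast_ne_zero.2 (NeZero.ne d)
  induction Y using op_induction with
  | hprod Y =>
    induction X using op_induction with
    | hprod X =>
      have hA : ∀ A : {A : Finset ℤ // A ∈ D.powerset},
          normTrace D (embed (Finset.mem_powerset.1 A.2)
            (component ((Finset.mem_powerset.1 A.2).trans hD) (chainOp B Y) : Op d A.1) *
              chainOp D X) =
          (∏ b ∈ B \ D, (Y b).trace / d) * ((∏ a ∈ A.1, (tracelessPart (Y a) * X a).trace / d) *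
            ∏ a ∈ D \ A.1, ((Y a).trace / d) * ((X a).trace / d)) := by
        rintro ⟨A, hA⟩
        have hA := Finset.mem_powerset.1 hA
        have hDs : ∀ f : ℤ → ℂ, ∏ a ∈ D, f a = (∏ a ∈ D \ A, f a) * ∏ a ∈ A, f a := fun f =>
          (Finset.prod_sdiff hA).symm
        rw [component_chainOp, embed_smul, smul_mul_assoc, map_smul, embed_chainOp, chainOp_mul,
          normTrace_chainOp, smul_eq_mul, ← Finset.prod_sdiff hD, hDs, hDs,
          Finset.prod_mul_distrib]
        have e1 : (∏ b ∈ B \ D, if b ∈ A then 1 else (Y b).trace / (d : ℂ)) =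
            ∏ b ∈ B \ D, (Y b).trace / d := Finset.prod_congr rfl fun b hb => by
          rw [if_neg fun h => (Finset.mem_sdiff.1 hb).2 (hA h)]
        have e2 : (∏ b ∈ D \ A, if b ∈ A then 1 else (Y b).trace / (d : ℂ)) =
            ∏ b ∈ D \ A, (Y b).trace / d := Finset.prod_congr rfl fun b hb => by
          rw [if_neg (Finset.mem_sdiff.1 hb).2]
        have e3 : (∏ b ∈ A, if b ∈ A then 1 else (Y b).trace / (d : ℂ)) = 1 :=
          Finset.prod_eq_one fun b hb => by rw [if_pos hb]
        have e4 : (∏ b ∈ D \ A, ((if b ∈ A then tracelessPart (Y b) else 1) * X b).trace / (d : ℂ))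
            = ∏ b ∈ D \ A, (X b).trace / d := Finset.prod_congr rfl fun b hb => by
          rw [if_neg (Finset.mem_sdiff.1 hb).2, one_mul]
        have e5 : (∏ b ∈ A, ((if b ∈ A then tracelessPart (Y b) else 1) * X b).trace / (d : ℂ))
            = ∏ b ∈ A, (tracelessPart (Y b) * X b).trace / d := Finset.prod_congr rfl fun b hb => by
          rw [if_pos hb]
        rw [e1, e2, e3, e4, e5]
        ring
      -- Summing over `A ⊆ D` expands a product over `D` of two-term sums; at each site the two
      -- terms recombine as `tr (Y X) / d = tr (Y₀ X) / d + (tr Y / d) (tr X / d)`, with `Y₀` the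
      -- traceless part.
      rw [Finset.sum_congr rfl fun A _ => hA A, ← Finset.mul_sum,
        Finset.sum_coe_sort D.powerset fun A =>
          ((∏ a ∈ A, (tracelessPart (Y a) * X a).trace / (d : ℂ)) *
            ∏ a ∈ D \ A, ((Y a).trace / d) * ((X a).trace / d)), ← Finset.prod_add,
        embed_chainOp, chainOp_mul, normTrace_chainOp, ← Finset.prod_sdiff hD]
      congr 1
      · refine Finset.prod_congr rfl fun b hb => ?_
        rw [if_neg (Finset.mem_sdiff.1 hb).2, mul_one]
      · refine Finset.prod_congr rfl fun b hb => ?_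
        rw [if_pos hb, tracelessPart, sub_mul, Matrix.trace_sub, smul_mul_assoc, one_mul,
          Matrix.trace_smul, smul_eq_mul]
        field_simp
        ring
    | hadd X Z hX hZ =>
      simp only [mul_add, map_add, embed_add, Finset.sum_add_distrib, hX, hZ]
    | hsmul c X hX => simp only [mul_smul_comm, map_smul, embed_smul, ← Finset.smul_sum, hX]
  | hadd Y Z hY hZ =>
    simp only [component_add, Submodule.coe_add, embed_add, add_mul, map_add,
      Finset.sum_add_distrib, hY, hZ]
  | hsmul c Y hY =>
    simp only [component_smul, Submodule.coe_smul, embed_smul, smul_mul_assoc, map_smul,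
      ← Finset.smul_sum, hY]

theorem tracelessPart_one : tracelessPart (1 : Matrix (Fin d) (Fin d) ℂ) = 0 := by
  have hd : (d : ℂ) ≠ 0 := Nat.cast_ne_zero.2 (NeZero.ne d)
  simp [tracelessPart, hd]

theorem component_embed_eq_zero {A B C : Finset ℤ} (h : A ⊆ B) (hC : C ⊆ B) (hAC : ¬ A ⊆ C)
    (X : Op d C) : component h (embed hC X) = 0 := by
  obtain ⟨a, ha, haC⟩ := Finset.not_subset.1 hAC
  induction X using op_induction with
  | hprod X =>
    refine Subtype.ext ?_
    rw [embed_chainOp, component_chainOp, smul_eq_zero_of_right]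
    · rfl
    · ext σ σ'
      exact Finset.prod_eq_zero (i := (⟨a, ha⟩ : A)) (Finset.mem_univ _)
        (by simp [haC, tracelessPart_one])
  | hadd Y Z hY hZ => rw [embed_add, component_add, hY, hZ, add_zero]
  | hsmul c Y hY => rw [embed_smul, component_smul, hY, smul_zero]

theorem component_conjTranspose {A B : Finset ℤ} (h : A ⊆ B) (X : Op d B) :
    (component h X.conjTranspose : Op d A) = (component h X : Op d A).conjTranspose := by
  induction X using op_induction with
  | hprod X =>
    rw [conjTranspose_chainOp, component_chainOp, component_chainOp, Matrix.conjTranspose_smul,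
      conjTranspose_chainOp]
    congr 1
    · rw [star_prod]
      refine Finset.prod_congr rfl fun b _ => ?_
      split_ifs <;> simp [Matrix.trace_conjTranspose]
    · simp only [conjTranspose_tracelessPart]
  | hadd Y Z hY hZ =>
    simp only [Matrix.conjTranspose_add, component_add, Submodule.coe_add, hY, hZ]
  | hsmul c Y hY =>
    simp only [Matrix.conjTranspose_smul, component_smul, Submodule.coe_smul, hY]

end FiniteRegions

/-! ### The algebra of operators with finite support -/

section LocalAlgebra

variable {d : ℕ}

instance : DirectedSystem (Op d) (fun _ _ h => embedHom (d := d) _ _ h) where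
  map_self _ X := embed_self subset_rfl X
  map_map _ _ _ hAB hBC X := embed_embed hAB hBC X

/-- The algebra of operators with finite support, the union of the operators on finite regions. -/
def LocalAlg (d : ℕ) : Type := DirectLimit (Op d) (embedHom (d := d))

noncomputable instance : Ring (LocalAlg d) :=
  inferInstanceAs (Ring (DirectLimit (Op d) (embedHom (d := d))))

noncomputable instance : Algebra ℂ (LocalAlg d) :=
  inferInstanceAs (Algebra ℂ (DirectLimit (Op d) (embedHom (d := d))))

/-- The inclusion of the operators on `A`. -/
noncomputable def ofOp (A : Finset ℤ) : Op d A →ₐ[ℂ] LocalAlg d :=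
  AlgHom.ofLinearMap (DirectLimit.Module.of ℂ (Finset ℤ) (Op d) embedHom A)
    (DirectLimit.one_def (f := embedHom (d := d)) A).symm
    fun X Y => (DirectLimit.mul_def (f := embedHom (d := d)) A X Y).symm

theorem ofOp_embed {A B : Finset ℤ} (h : A ⊆ B) (X : Op d A) : ofOp B (embed h X) = ofOp A X :=
  DirectLimit.Module.of_f (R := ℂ) (f := embedHom (d := d)) (hij := h)

theorem exists_eq_ofOp (X : LocalAlg d) : ∃ A Y, X = ofOp A Y :=
  DirectLimit.exists_eq_mk _ X

theorem ofOp_mem_range {A B : Finset ℤ} (h : A ⊆ B) (X : Op d A) :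
    ofOp A X ∈ (ofOp (d := d) B).range := ⟨embed h X, ofOp_embed h X⟩

theorem ofOp_mul_comm {A C : Finset ℤ} (hd : Disjoint A C) (X : Op d A) (Y : Op d C) :
    ofOp A X * ofOp C Y = ofOp C Y * ofOp A X := by
  rw [← ofOp_embed Finset.subset_union_left X, ← ofOp_embed Finset.subset_union_right Y, ← map_mul,
    embed_mul_comm _ _ hd, map_mul]

theorem ofOp_restrict (Φ : FormalOp d) (B : Finset ℤ) :
    ofOp B (restrict Φ B) = ∑ A ∈ B.powerset, ofOp A (Φ A : Op d A) := by
  rw [restrict, map_sum, ← Finset.sum_coe_sort B.powerset]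
  exact Finset.sum_congr rfl fun A _ => ofOp_embed _ _

/-! ### Regions around a set of sites -/

/-- The sites at distance at most `n` from `D`. -/
noncomputable def thicken (n : ℕ) (D : Finset ℤ) : Finset ℤ :=
  D.biUnion fun a => Finset.Icc (a - n) (a + n)

theorem subset_thicken (n : ℕ) (D : Finset ℤ) : D ⊆ thicken n D := fun a ha =>
  Finset.mem_biUnion.2 ⟨a, ha, Finset.mem_Icc.2 (by omega)⟩

theorem AtMostLocal.subset_thicken {n : ℕ} {Φ : FormalOp d} (hΦ : AtMostLocal n Φ)
    {A D : Finset ℤ} (hA : Φ A ≠ 0) (hD : ¬ Disjoint A D) : A ⊆ thicken n D := by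
  obtain ⟨a, haA, haD⟩ := Finset.not_disjoint_iff.1 hD
  have hr := hΦ _ hA
  intro c hc
  rw [setRange, dif_pos ⟨a, haA⟩] at hr
  have h1 := Finset.le_max' _ a haA
  have h2 := Finset.min'_le _ a haA
  have h3 := Finset.le_max' _ c hc
  have h4 := Finset.min'_le _ c hc
  exact Finset.mem_biUnion.2 ⟨a, haD, Finset.mem_Icc.2 (by omega)⟩

theorem atMostLocal_zero : AtMostLocal 0 (0 : FormalOp d) := fun _ hA => absurd rfl hA

/-- The commutator of a local operator with an operator on `D` only involves terms near `D`. -/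
theorem ofOp_restrict_commutator {n : ℕ} {Φ : FormalOp d} (hΦ : AtMostLocal n Φ)
    {B D : Finset ℤ} (hB : thicken n D ⊆ B) (X : Op d D) :
    ofOp B (restrict Φ B) * ofOp D X - ofOp D X * ofOp B (restrict Φ B) =
      ofOp _ (restrict Φ (thicken n D)) * ofOp D X -
        ofOp D X * ofOp _ (restrict Φ (thicken n D)) := by
  simp only [ofOp_restrict, Finset.sum_mul, Finset.mul_sum, ← Finset.sum_sub_distrib]
  symm
  refine Finset.sum_subset (Finset.powerset_mono.2 hB) fun A _ hA => ?_
  rw [Finset.mem_powerset] at hA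
  by_cases hz : Φ A = 0
  · simp [hz]
  by_cases hd : Disjoint A D
  · rw [ofOp_mul_comm hd, sub_self]
  · exact absurd (hΦ.subset_thicken hz hd) hA

/-! ### The trace and the pairing with formal operators -/

variable [NeZero d]

/-- The normalized trace of an operator with finite support. -/
noncomputable def locTrace : LocalAlg d →ₗ[ℂ] ℂ :=
  DirectLimit.Module.lift ℂ (Finset ℤ) (Op d) embedHom normTrace
    fun _ _ h X => normTrace_embed h X

theorem locTrace_ofOp {A : Finset ℤ} (X : Op d A) : locTrace (ofOp A X) = normTrace A X := rfl

theorem locTrace_mul_comm (X Y : LocalAlg d) : locTrace (X * Y) = locTrace (Y * X) := by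
  obtain ⟨A, X, rfl⟩ := exists_eq_ofOp X
  obtain ⟨C, Y, rfl⟩ := exists_eq_ofOp Y
  rw [← ofOp_embed Finset.subset_union_left X, ← ofOp_embed Finset.subset_union_right Y, ← map_mul,
    ← map_mul, locTrace_ofOp, locTrace_ofOp, normTrace_mul_comm]

theorem locTrace_nondegenerate (X : LocalAlg d) (h : ∀ Y, locTrace (Y * X) = 0) : X = 0 := by
  obtain ⟨A, X, rfl⟩ := exists_eq_ofOp X
  rw [eq_zero_of_normTrace (X := X) fun Y => ?_, map_zero]
  rw [← locTrace_ofOp, map_mul]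
  exact h _

theorem locTrace_mul_eq_zero {A C : Finset ℤ} (hAC : ¬ A ⊆ C) {X : Op d A}
    (hX : X ∈ tracelessOps d A) (Y : Op d C) : locTrace (ofOp A X * ofOp C Y) = 0 := by
  rw [← ofOp_embed Finset.subset_union_left X, ← ofOp_embed Finset.subset_union_right Y, ← map_mul,
    locTrace_ofOp, normTrace_mul_embed_eq_zero _ _ hAC hX]

/-- Terms of `Φ` not supported inside `A` are orthogonal to operators on `A`; this makes `pairing`
compatible with enlarging the region. -/
theorem locTrace_restrict_mul (Φ : FormalOp d) {A B : Finset ℤ} (h : A ⊆ B) (X : Op d A) :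
    locTrace (ofOp B (restrict Φ B) * ofOp A X) = locTrace (ofOp A (restrict Φ A) * ofOp A X) := by
  rw [ofOp_restrict, ofOp_restrict, Finset.sum_mul, Finset.sum_mul, map_sum, map_sum]
  symm
  refine Finset.sum_subset (Finset.powerset_mono.2 h) fun C _ hC => ?_
  exact locTrace_mul_eq_zero (by simpa using hC) (Φ C).2 X

/-- The pairing of a formal operator with the operators of finite support under the trace. -/
noncomputable def pairing (Φ : FormalOp d) : LocalAlg d →ₗ[ℂ] ℂ :=
  DirectLimit.Module.lift ℂ (Finset ℤ) (Op d) embedHom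
    (fun A => normTrace A ∘ₗ LinearMap.mulLeft ℂ (restrict Φ A)) fun A B h X => by
      have := locTrace_restrict_mul Φ h X
      rwa [← ofOp_embed h X, ← map_mul, locTrace_ofOp, ofOp_embed, ← map_mul, locTrace_ofOp] at this

theorem pairing_ofOp (Φ : FormalOp d) {A : Finset ℤ} (X : Op d A) :
    pairing Φ (ofOp A X) = normTrace A (restrict Φ A * X) := rfl

theorem pairing_eq (Φ : FormalOp d) {B : Finset ℤ} {X : LocalAlg d}
    (hX : X ∈ (ofOp (d := d) B).range) :
    pairing Φ X = locTrace (ofOp B (restrict Φ B) * X) := by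
  obtain ⟨X, rfl⟩ := hX
  exact (pairing_ofOp Φ X).trans (by rw [← locTrace_ofOp, map_mul]; rfl)

theorem pairing_eq_sum (Φ : FormalOp d) {B : Finset ℤ} {X : LocalAlg d}
    (hX : X ∈ (ofOp (d := d) B).range) :
    pairing Φ X = ∑ A ∈ B.powerset, locTrace (ofOp A (Φ A : Op d A) * X) := by
  rw [pairing_eq Φ hX, ofOp_restrict, Finset.sum_mul, map_sum]

/-- A term of `Φ` on a proper subset of `A` misses a site where `X` is traceless, so only `Φ A`
contributes. -/
theorem pairing_traceless (Φ : FormalOp d) {A : Finset ℤ} {X : Op d A}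
    (hX : X ∈ tracelessOps d A) :
    pairing Φ (ofOp A X) = normTrace A ((Φ A : Op d A) * X) := by
  rw [pairing_eq_sum Φ (ofOp_mem_range subset_rfl X),
    Finset.sum_eq_single_of_mem A (Finset.mem_powerset_self A),
    ← map_mul, locTrace_ofOp]
  intro C hC hCA
  rw [locTrace_mul_comm]
  exact locTrace_mul_eq_zero
    (fun h => hCA ((Finset.mem_powerset.1 hC).antisymm h)) hX (Φ C : Op d C)

/-- Testing against the adjoint of `Φ A` gives its Hilbert–Schmidt norm, so the functional
determines each component. -/
theorem eq_zero_of_pairing_conjTranspose {Φ : FormalOp d} {A : Finset ℤ}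
    (h : pairing Φ (ofOp A (Φ A : Op d A).conjTranspose) = 0) : Φ A = 0 := by
  rw [pairing_traceless Φ (conjTranspose_mem (Φ A).2)] at h
  exact Subtype.ext (eq_zero_of_normTrace_mul_conjTranspose h)

theorem pairing_add (Φ Ψ : FormalOp d) : pairing (Φ + Ψ) = pairing Φ + pairing Ψ := by
  ext X
  obtain ⟨A, X, rfl⟩ := exists_eq_ofOp X
  simp only [LinearMap.add_apply, pairing_eq_sum _ (⟨X, rfl⟩ : ofOp A X ∈ (ofOp A).range),
    ← Finset.sum_add_distrib, ← map_add, ← add_mul]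
  rfl

theorem pairing_smul (c : ℂ) (Φ : FormalOp d) : pairing (c • Φ) = c • pairing Φ := by
  ext X
  obtain ⟨A, X, rfl⟩ := exists_eq_ofOp X
  simp only [LinearMap.smul_apply, pairing_eq_sum _ (⟨X, rfl⟩ : ofOp A X ∈ (ofOp A).range),
    Finset.smul_sum, ← map_smul, ← smul_mul_assoc]
  rfl

theorem pairing_neg (Φ : FormalOp d) : pairing (-Φ) = -pairing Φ := by
  have := pairing_smul (-1) Φ
  rwa [neg_one_smul ℂ Φ, neg_one_smul ℂ (pairing Φ)] at this

theorem pairing_zero : pairing (0 : FormalOp d) = 0 := by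
  have := pairing_smul 0 (0 : FormalOp d)
  rwa [zero_smul, zero_smul] at this

theorem pairing_injective : Function.Injective (pairing (d := d)) := by
  intro Φ Ψ h
  rw [← sub_eq_zero]
  funext A
  refine eq_zero_of_pairing_conjTranspose ?_
  rw [sub_eq_add_neg, pairing_add, pairing_neg, h, add_neg_cancel, LinearMap.zero_apply]

/-! ### Commutators -/

theorem locTrace_mul_commutator {n : ℕ} {Φ : FormalOp d} (hΦ : AtMostLocal n Φ)
    {B D : Finset ℤ} (hB : thicken n D ⊆ B) (X : Op d D) (Y : LocalAlg d) :
    locTrace (Y * (ofOp B (restrict Φ B) * ofOp D X - ofOp D X * ofOp B (restrict Φ B))) =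
      pairing Φ (ofOp D X * Y - Y * ofOp D X) := by
  obtain ⟨E, Y, rfl⟩ := exists_eq_ofOp Y
  have hX : ofOp D X ∈ (ofOp (d := d) (thicken n D ∪ E)).range :=
    ofOp_mem_range ((subset_thicken n D).trans Finset.subset_union_left) X
  have hY : ofOp E Y ∈ (ofOp (d := d) (thicken n D ∪ E)).range :=
    ofOp_mem_range Finset.subset_union_right Y
  -- The commutator does not depend on the region once it contains `thicken n D`, so `B` is traded
  -- for a region that also contains the support `E` of `Y`; there the pairing is an honest trace
  -- and cyclicity applies.
  rw [ofOp_restrict_commutator hΦ hB,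
    ← ofOp_restrict_commutator hΦ (Finset.subset_union_left (s₂ := E)),
    pairing_eq Φ (sub_mem (mul_mem hX hY) (mul_mem hY hX)), mul_sub, mul_sub, map_sub, map_sub,
    ← mul_assoc, locTrace_mul_comm _ (ofOp D X), ← mul_assoc, locTrace_mul_comm (ofOp D X * _),
    ← mul_assoc (ofOp E Y) (ofOp D X), locTrace_mul_comm (ofOp E Y * ofOp D X)]

theorem exists_isAd_pairing {n : ℕ} {Φ : FormalOp d} (hΦ : AtMostLocal n Φ) :
    ∃ δ, IsAd locTrace (pairing Φ) δ := by
  refine exists_isAd locTrace_nondegenerate fun X => ?_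
  obtain ⟨D, X, rfl⟩ := exists_eq_ofOp X
  exact ⟨_, locTrace_mul_commutator hΦ subset_rfl X⟩

theorem IsAd.eq_commutator {n : ℕ} {Φ : FormalOp d} (hΦ : AtMostLocal n Φ)
    {δ : LocalAlg d →ₗ[ℂ] LocalAlg d} (hδ : IsAd locTrace (pairing Φ) δ) {B D : Finset ℤ}
    (hB : thicken n D ⊆ B) (X : Op d D) :
    δ (ofOp D X) = ofOp B (restrict Φ B) * ofOp D X - ofOp D X * ofOp B (restrict Φ B) := by
  rw [← sub_eq_zero]
  refine locTrace_nondegenerate _ fun Y => ?_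
  rw [mul_sub Y (δ _), map_sub, hδ, locTrace_mul_commutator hΦ hB, sub_self]

/-- The pairing of a commutator, through the derivation of its local factor. -/
theorem pairing_comm {n : ℕ} {Φ : FormalOp d} (hΦ : AtMostLocal n Φ)
    {δ : LocalAlg d →ₗ[ℂ] LocalAlg d} (hδ : IsAd locTrace (pairing Φ) δ) (Ψ : FormalOp d) :
    pairing (comm Φ Ψ) = -(pairing Ψ ∘ₗ δ) := by
  ext X
  obtain ⟨D, X, rfl⟩ := exists_eq_ofOp X
  choose B₀ hB₀ using fun A => isCommAt_comm hΦ Ψ A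
  -- `B` must serve two purposes: contain everything `Φ` needs to act on `X`, and be large enough
  -- for every component `A ⊆ D` of the commutator to have stabilized.
  set B := thicken n D ∪ D.powerset.biUnion B₀ with hBdef
  have hU : thicken n D ⊆ B := Finset.subset_union_left
  have hD : D ⊆ B := (subset_thicken n D).trans hU
  have hX : ofOp D X ∈ (ofOp (d := d) B).range := ofOp_mem_range hD X
  have hΦB : ofOp B (restrict Φ B) ∈ (ofOp (d := d) B).range := ⟨_, rfl⟩
  have key : pairing (comm Φ Ψ) (ofOp D X) =
      normTrace B ((restrict Φ B * restrict Ψ B - restrict Ψ B * restrict Φ B) * embed hD X) := by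
    rw [pairing_ofOp, restrict, Finset.sum_mul, map_sum, ← sum_normTrace_component]
    refine Finset.sum_congr rfl fun A _ => ?_
    rw [hB₀ A.1 B ((Finset.subset_biUnion_of_mem B₀ A.2).trans Finset.subset_union_right)]
  rw [key, LinearMap.neg_apply, LinearMap.comp_apply, hδ.eq_commutator hΦ hU,
    pairing_eq Ψ (sub_mem (mul_mem hΦB hX) (mul_mem hX hΦB)), ← locTrace_ofOp, map_mul (ofOp B),
    map_sub (ofOp B), map_mul (ofOp B), map_mul (ofOp B), ofOp_embed, sub_mul, mul_sub, map_sub,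
    map_sub, neg_sub,
    mul_assoc (ofOp B (restrict Φ B)), locTrace_mul_comm (ofOp B (restrict Φ B)), mul_assoc,
    mul_assoc]

/-- The Jacobi identity. -/
theorem comm_comm {n m k : ℕ} {Φ Ψ : FormalOp d} (hΦ : AtMostLocal n Φ) (hΨ : AtMostLocal m Ψ)
    (hΦΨ : AtMostLocal k (comm Φ Ψ)) (Ω : FormalOp d) :
    comm (comm Φ Ψ) Ω = comm Φ (comm Ψ Ω) - comm Ψ (comm Φ Ω) := by
  obtain ⟨δ, hδ⟩ := exists_isAd_pairing hΦ
  obtain ⟨ε, hε⟩ := exists_isAd_pairing hΨ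
  have h := hδ.bracket locTrace_nondegenerate locTrace_mul_comm hε
  rw [← pairing_comm hΦ hδ] at h
  refine pairing_injective ?_
  rw [pairing_comm hΦΨ h, sub_eq_add_neg (comm Φ _), pairing_add, pairing_neg, pairing_comm hΦ hδ,
    pairing_comm hΨ hε, pairing_comm hΨ hε, pairing_comm hΦ hδ]
  ext X
  simp only [LinearMap.neg_apply, LinearMap.comp_apply, LinearMap.sub_apply, LinearMap.add_apply,
    map_sub]
  ring

theorem comm_zero {n : ℕ} {Φ : FormalOp d} (hΦ : AtMostLocal n Φ) : comm Φ 0 = 0 := by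
  obtain ⟨δ, hδ⟩ := exists_isAd_pairing hΦ
  refine pairing_injective ?_
  rw [pairing_comm hΦ hδ, pairing_zero, LinearMap.zero_comp, neg_zero]

theorem zero_comm (Ψ : FormalOp d) : comm 0 Ψ = 0 := by
  refine pairing_injective ?_
  rw [pairing_comm (δ := 0) atMostLocal_zero fun X Y => by simp [pairing_zero], pairing_zero,
    LinearMap.comp_zero, neg_zero]

theorem comm_neg {n : ℕ} {Φ : FormalOp d} (hΦ : AtMostLocal n Φ) (Ψ : FormalOp d) :
    comm Φ (-Ψ) = -comm Φ Ψ := by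
  obtain ⟨δ, hδ⟩ := exists_isAd_pairing hΦ
  refine pairing_injective ?_
  rw [pairing_comm hΦ hδ, pairing_neg, pairing_neg, pairing_comm hΦ hδ, LinearMap.neg_comp]

theorem comm_self {n : ℕ} {Φ : FormalOp d} (hΦ : AtMostLocal n Φ) : comm Φ Φ = 0 := by
  funext A
  refine (isCommAt_comm hΦ Φ A).unique ⟨∅, fun B _ h => ?_⟩
  rw [component_sub, sub_self]
  rfl

/-! ### Locality of commutators -/

theorem setRange_le {A : Finset ℤ} {n : ℕ} (h : ∀ a ∈ A, ∀ b ∈ A, b - a + 1 ≤ n) :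
    setRange A ≤ n := by
  rw [setRange]
  split_ifs with hA
  · have := h _ (A.min'_mem hA) _ (A.max'_mem hA)
    omega
  · exact Nat.zero_le _

theorem sub_lt_setRange {A : Finset ℤ} {a b : ℤ} (ha : a ∈ A) (hb : b ∈ A) :
    b - a + 1 ≤ setRange A := by
  rw [setRange, dif_pos ⟨a, ha⟩]
  have h1 := A.le_max' b hb
  have h2 := A.min'_le a ha
  omega

/-- Two terms contribute only if their supports share a site, and the result lives on the union; the
shared site is counted once, which saves one from the sum of the ranges. -/
theorem AtMostLocal.comm {n m : ℕ} {Φ Ψ : FormalOp d} (hΦ : AtMostLocal (n + 1) Φ)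
    (hΨ : AtMostLocal m Ψ) : AtMostLocal (n + m) (comm Φ Ψ) := by
  intro A hA
  obtain ⟨B₀, hB⟩ := isCommAt_comm hΦ Ψ A
  have h := hB (B₀ ∪ A) Finset.subset_union_left Finset.subset_union_right
  rw [← h, component_restrict] at hA
  obtain ⟨⟨P, P'⟩, -, hp⟩ := Finset.exists_ne_zero_of_sum_ne_zero hA
  split_ifs at hp with hPP
  swap
  · exact absurd rfl hp
  obtain ⟨hP, hP'⟩ := hPP
  dsimp only at hP hP' hp
  have hz : Φ P ≠ 0 := by rintro hz; simp [hz, embed_zero] at hp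
  have hz' : Ψ P' ≠ 0 := by rintro hz; simp [hz, embed_zero] at hp
  have hd : ¬ Disjoint P P' := fun hd => hp (by rw [embed_mul_comm hP hP' hd, sub_self])
  have hsub : A ⊆ P ∪ P' := by
    by_contra hsub
    refine hp ?_
    rw [← embed_embed Finset.subset_union_left (Finset.union_subset hP hP') (Φ P : Op d P),
      ← embed_embed Finset.subset_union_right (Finset.union_subset hP hP') (Ψ P' : Op d P'),
      ← embed_mul, ← embed_mul, component_embed_eq_zero _ _ hsub,
      component_embed_eq_zero _ _ hsub, sub_self]
  obtain ⟨c, hc, hc'⟩ := Finset.not_disjoint_iff.1 hd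
  have h1 := hΦ P hz
  have h2 := hΨ P' hz'
  refine setRange_le fun a ha b hb => ?_
  have hr := fun {a b} (ha : a ∈ P) (hb : b ∈ P) => sub_lt_setRange ha hb
  have hr' := fun {a b} (ha : a ∈ P') (hb : b ∈ P') => sub_lt_setRange ha hb
  have hcc := hr hc hc
  have hcc' := hr' hc' hc'
  rcases Finset.mem_union.1 (hsub ha) with ha | ha <;>
    rcases Finset.mem_union.1 (hsub hb) with hb | hb
  · have := hr ha hb
    push_cast; omega
  · have := hr ha hc
    have := hr' hc' hb
    push_cast; omega
  · have := hr' ha hc'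
    have := hr hc hb
    push_cast; omega
  · have := hr' ha hb
    push_cast; omega

end LocalAlgebra

/-! ### Translations of the local algebra -/

section Translation

variable {d : ℕ}

/-- The translation by `x` as an endomorphism of the algebra of operators with finite support. -/
noncomputable def shiftAlg (x : ℤ) : LocalAlg d →ₐ[ℂ] LocalAlg d :=
  let f : LocalAlg d →ₗ[ℂ] LocalAlg d := DirectLimit.Module.lift ℂ (Finset ℤ) (Op d) embedHom
    (fun A => (ofOp (shiftSet A x)).toLinearMap ∘ₗ ⟨⟨shiftOp x, shiftOp_add x⟩, shiftOp_smul x⟩)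
    fun _ _ h X => (congrArg (ofOp _) (shiftOp_embed h x X)).trans (ofOp_embed _ _)
  have hf : ∀ (A : Finset ℤ) (X : Op d A), f (ofOp A X) = ofOp _ (shiftOp x X) := fun _ _ => rfl
  AlgHom.ofLinearMap f
    (by rw [← map_one (ofOp (d := d) ∅), hf, shiftOp_one, map_one, map_one])
    (fun X Y => by
      obtain ⟨A, X, rfl⟩ := exists_eq_ofOp X
      obtain ⟨C, Y, rfl⟩ := exists_eq_ofOp Y
      rw [← ofOp_embed Finset.subset_union_left X, ← ofOp_embed Finset.subset_union_right Y,
        ← map_mul, hf, hf, hf, shiftOp_mul, map_mul])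

theorem shiftAlg_ofOp (x : ℤ) {A : Finset ℤ} (X : Op d A) :
    shiftAlg x (ofOp A X) = ofOp (shiftSet A x) (shiftOp x X) := rfl

theorem exists_eq_shiftSet (A : Finset ℤ) (x : ℤ) : ∃ D, A = shiftSet D x :=
  ⟨shiftSet A (-x), by rw [shiftSet_shiftSet, neg_add_cancel, shiftSet_zero]⟩

theorem shiftAlg_surjective (x : ℤ) : Function.Surjective (shiftAlg (d := d) x) := by
  intro Y
  obtain ⟨A, Y, rfl⟩ := exists_eq_ofOp Y
  obtain ⟨A, rfl⟩ := exists_eq_shiftSet A x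
  obtain ⟨Y, rfl⟩ := shiftOp_surjective x Y
  exact ⟨ofOp A Y, rfl⟩

variable [NeZero d]

theorem locTrace_shiftAlg (x : ℤ) (X : LocalAlg d) : locTrace (shiftAlg x X) = locTrace X := by
  obtain ⟨A, X, rfl⟩ := exists_eq_ofOp X
  rw [shiftAlg_ofOp, locTrace_ofOp, locTrace_ofOp, normTrace_shiftOp]

theorem pairing_shiftAlg {Φ Ψ : FormalOp d} {x : ℤ}
    (h : ∀ A, (Φ (shiftSet A x) : Op d (shiftSet A x)) = shiftOp x (Ψ A : Op d A))
    (X : LocalAlg d) : pairing Φ (shiftAlg x X) = pairing Ψ X := by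
  obtain ⟨D, X, rfl⟩ := exists_eq_ofOp X
  rw [pairing_eq_sum Ψ (ofOp_mem_range subset_rfl X), shiftAlg_ofOp,
    pairing_eq_sum Φ (ofOp_mem_range subset_rfl _)]
  symm
  refine Finset.sum_bij (fun A _ => shiftSet A x) ?_ ?_ ?_ ?_
  · intro A hA
    exact Finset.mem_powerset.2 (shiftSet_mono (Finset.mem_powerset.1 hA) x)
  · intro A _ A' _ hAA
    exact Finset.map_injective _ hAA
  · intro A hA
    obtain ⟨A, rfl⟩ := exists_eq_shiftSet A x
    exact ⟨A, Finset.mem_powerset.2 (Finset.map_subset_map.1 (Finset.mem_powerset.1 hA)), rfl⟩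
  · intro A _
    rw [h, ← shiftAlg_ofOp, ← shiftAlg_ofOp, ← map_mul, locTrace_shiftAlg]

theorem isTranslationInvariant_of_pairing {Φ : FormalOp d}
    (h : ∀ x X, pairing Φ (shiftAlg x X) = pairing Φ X) : IsTranslationInvariant Φ := by
  intro A x
  set W : Op d (shiftSet A x) := (Φ (shiftSet A x) : Op d _) - shiftOp x (Φ A : Op d A) with hW
  have hWm : W ∈ tracelessOps d (shiftSet A x) := sub_mem (Φ _).2 (shiftOp_mem x (Φ A).2)
  -- The discrepancy `W` is tested against its own adjoint, written as the translate of an operator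
  -- `V` on `A` so that the hypothesis applies.
  obtain ⟨V, hVm, hV⟩ := exists_shiftOp_eq_of_mem (conjTranspose_mem hWm)
  rw [← sub_eq_zero]
  refine eq_zero_of_normTrace_mul_conjTranspose ?_
  rw [← hW, ← hV, hW, sub_mul, map_sub, ← shiftOp_mul, normTrace_shiftOp,
    ← pairing_traceless Φ hVm, hV, ← pairing_traceless Φ (conjTranspose_mem hWm), ← hV,
    ← shiftAlg_ofOp, h, sub_self]

/-- If translations change `Φ` only by multiples of an operator commuting with `Ψ`, then `[Φ, Ψ]`
is translation invariant. -/
theorem isTranslationInvariant_comm {n m : ℕ} {Φ Θ Ψ : FormalOp d} (hΦ : AtMostLocal n Φ)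
    (hΘ : AtMostLocal m Θ) (hinv : ∀ A (x : ℤ),
      (Φ (shiftSet A x) : Op d (shiftSet A x)) = shiftOp x ((Φ + (x : ℂ) • Θ) A : Op d A))
    (hΨ : IsTranslationInvariant Ψ) (hcomm : comm Θ Ψ = 0) :
    IsTranslationInvariant (comm Φ Ψ) := by
  obtain ⟨δ, hδ⟩ := exists_isAd_pairing hΦ
  obtain ⟨ε, hε⟩ := exists_isAd_pairing hΘ
  refine isTranslationInvariant_of_pairing fun x X => ?_
  have had : IsAd locTrace (pairing Φ ∘ₗ (shiftAlg x).toLinearMap) (δ + (x : ℂ) • ε) := by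
    intro X Y
    rw [LinearMap.comp_apply, AlgHom.toLinearMap_apply, pairing_shiftAlg fun A => hinv A x,
      pairing_add, pairing_smul]
    simp [mul_add, ← hδ X Y, ← hε X Y, -map_sub]
  -- Since `[Θ, Ψ] = 0`, the functional of `Ψ` vanishes on the range of `ε`, so the extra `x • ε` in
  -- the translated derivation is invisible.
  have h0 := congrArg (fun f => f X) (pairing_comm hΘ hε Ψ)
  simp only [hcomm, pairing_zero, LinearMap.zero_apply, LinearMap.neg_apply,
    LinearMap.comp_apply, zero_eq_neg] at h0
  rw [pairing_comm hΦ hδ, LinearMap.neg_apply, LinearMap.neg_apply, LinearMap.comp_apply,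
    LinearMap.comp_apply, ← hδ.map_comp locTrace_nondegenerate (shiftAlg_surjective x)
      (locTrace_shiftAlg x) had, pairing_shiftAlg fun A => hΨ A x]
  simp [h0]

end Translation

/-! ### Adjoints -/

section Adjoint

variable {d : ℕ}

/-- The adjoint of a formal operator. -/
def adjoint (Φ : FormalOp d) : FormalOp d := fun A =>
  ⟨(Φ A : Op d A).conjTranspose, conjTranspose_mem (Φ A).2⟩

theorem adjoint_apply (Φ : FormalOp d) (A : Finset ℤ) :
    (adjoint Φ A : Op d A) = (Φ A : Op d A).conjTranspose := rfl

theorem adjoint_eq_zero_iff {Φ : FormalOp d} {A : Finset ℤ} : adjoint Φ A = 0 ↔ Φ A = 0 := by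
  rw [← Subtype.coe_inj, ← Subtype.coe_inj, adjoint_apply]
  exact Matrix.conjTranspose_eq_zero

theorem AtMostLocal.adjoint {n : ℕ} {Φ : FormalOp d} (hΦ : AtMostLocal n Φ) :
    AtMostLocal n (adjoint Φ) := fun A hA => hΦ A (mt adjoint_eq_zero_iff.2 hA)

theorem IsHermitian.adjoint_eq {Φ : FormalOp d} (hΦ : IsHermitian Φ) : adjoint Φ = Φ :=
  funext fun A => Subtype.ext (hΦ A)

theorem IsTranslationInvariant.adjoint {Φ : FormalOp d} (hΦ : IsTranslationInvariant Φ) :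
    IsTranslationInvariant (adjoint Φ) := by
  intro A x
  rw [adjoint_apply, adjoint_apply, hΦ]
  rfl

theorem restrict_adjoint (Φ : FormalOp d) (B : Finset ℤ) :
    restrict (adjoint Φ) B = (restrict Φ B).conjTranspose := by
  simp only [restrict, Matrix.conjTranspose_sum, adjoint_apply, embed_conjTranspose]

theorem adjoint_comm [NeZero d] {n : ℕ} {Φ : FormalOp d} (hΦ : AtMostLocal n Φ) (Ψ : FormalOp d) :
    comm (adjoint Φ) (adjoint Ψ) = -adjoint (comm Φ Ψ) := by
  funext A
  refine (isCommAt_comm hΦ.adjoint (adjoint Ψ) A).unique ?_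
  obtain ⟨B, hB⟩ := isCommAt_comm hΦ Ψ A
  refine ⟨B, fun B' h h' => Subtype.ext ?_⟩
  rw [restrict_adjoint, restrict_adjoint, ← Matrix.conjTranspose_mul, ← Matrix.conjTranspose_mul,
    ← Matrix.conjTranspose_sub, component_conjTranspose, Pi.neg_apply, Submodule.coe_neg,
    adjoint_apply, ← hB B' h h', component_sub, component_sub, ← Matrix.conjTranspose_neg,
    ← Submodule.coe_neg, neg_sub]

end Adjoint

/-! ### Sums over translation classes of regions -/

section MassTransport

/-- The regions inside `{0, …, M}` that contain their left end `0`. -/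
noncomputable def shapes (M : ℕ) : Finset (Finset ℤ) :=
  (Finset.Icc 0 (M : ℤ)).powerset.filter (0 ∈ ·)

theorem mem_shapes {M : ℕ} {A : Finset ℤ} :
    A ∈ shapes M ↔ (∀ a ∈ A, 0 ≤ a ∧ a ≤ M) ∧ 0 ∈ A := by
  simp [shapes, Finset.subset_iff]

theorem exists_shape {M : ℕ} {A : Finset ℤ} (hA : A.Nonempty) (hr : setRange A ≤ M) :
    ∃ D ∈ shapes M, A = shiftSet D (A.min' hA) := by
  refine ⟨shiftSet A (-A.min' hA), mem_shapes.2 ⟨fun a ha => ?_, ?_⟩, ?_⟩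
  · rw [mem_shiftSet] at ha
    have h1 := sub_lt_setRange (A.min'_mem hA) ha
    have h2 := A.min'_le _ ha
    omega
  · rw [mem_shiftSet]
    simpa using A.min'_mem hA
  · rw [shiftSet_shiftSet, neg_add_cancel, shiftSet_zero]

theorem shiftSet_injOn_shapes {M : ℕ} {A D : Finset ℤ} (hA : A ∈ shapes M) (hD : D ∈ shapes M)
    {x y : ℤ} (h : shiftSet A x = shiftSet D y) : A = D ∧ x = y := by
  rw [mem_shapes] at hA hD
  have h1 : x ∈ shiftSet D y := by rw [← h, mem_shiftSet]; simpa using hA.2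
  have h2 : y ∈ shiftSet A x := by rw [h, mem_shiftSet]; simpa using hD.2
  rw [mem_shiftSet] at h1 h2
  have := hD.1 _ h1
  have := hA.1 _ h2
  obtain rfl : x = y := by omega
  exact ⟨Finset.map_injective _ h, rfl⟩

/-- A nonempty region is determined by its shape and its left end. The window holds all translates
of shapes by at most `n`, and `g` vanishes on the rest of it. -/
theorem sum_powerset_eq_sum_shapes {M n : ℕ} (g : Finset ℤ → ℂ)
    (hg : ∀ D, g D ≠ 0 → ∃ hD : D.Nonempty, setRange D ≤ M ∧ -n ≤ D.min' hD ∧ D.min' hD ≤ n) :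
    ∑ D ∈ (Finset.Icc (-n : ℤ) (M + n)).powerset, g D =
      ∑ D ∈ shapes M, ∑ x ∈ Finset.Icc (-n : ℤ) n, g (shiftSet D x) := by
  rw [← Finset.sum_product']
  symm
  refine Finset.sum_of_injOn (fun p : Finset ℤ × ℤ => shiftSet p.1 p.2) ?_ ?_ ?_ fun _ _ => rfl
  · rintro ⟨A, x⟩ hA ⟨D, y⟩ hD h
    have := shiftSet_injOn_shapes (Finset.mem_product.1 hA).1 (Finset.mem_product.1 hD).1 h
    exact Prod.ext this.1 this.2
  · rintro ⟨A, x⟩ hA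
    obtain ⟨hA, hx⟩ := Finset.mem_product.1 hA
    have hx := Finset.mem_Icc.1 hx
    refine Finset.mem_powerset.2 fun a ha => Finset.mem_Icc.2 ?_
    have := (mem_shapes.1 hA).1 _ (mem_shiftSet.1 ha)
    dsimp only at hx this
    omega
  · intro D _ hD
    by_contra hne
    obtain ⟨hne, hr, h1, h2⟩ := hg D hne
    obtain ⟨A, hA, hAD⟩ := exists_shape hne hr
    exact hD ⟨(A, D.min' hne), Finset.mem_product.2 ⟨hA, Finset.mem_Icc.2 ⟨h1, h2⟩⟩, hAD.symm⟩

/-- The shape `A` starts at `0`. As `D` stays within `n` of `A`, it cannot begin left of `-n`; as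
some site of `D` is within `n` of `0`, it cannot begin right of `n`. -/
theorem min'_mem_Icc_of_shape {M n : ℕ} {A D : Finset ℤ} (hA : A ∈ shapes M)
    (hDA : D ⊆ thicken n A) (hAD : A ⊆ thicken n D) :
    ∃ hD : D.Nonempty, -n ≤ D.min' hD ∧ D.min' hD ≤ n := by
  rw [mem_shapes] at hA
  obtain ⟨b, hb, hb0⟩ := Finset.mem_biUnion.1 (hAD hA.2)
  refine ⟨⟨b, hb⟩, ?_, ?_⟩
  · obtain ⟨a, ha, hm⟩ := Finset.mem_biUnion.1 (hDA (D.min'_mem ⟨b, hb⟩))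
    have := hA.1 a ha
    have := Finset.mem_Icc.1 hm
    omega
  · have := D.min'_le b hb
    have := Finset.mem_Icc.1 hb0
    omega

/-- Exchanging the summations in a translation-invariant finite-range double sum. -/
theorem sum_shapes_comm {M n : ℕ} (f : Finset ℤ → Finset ℤ → ℂ)
    (hshift : ∀ A D x, f (shiftSet A x) (shiftSet D x) = f A D)
    (hsub : ∀ A D, f A D ≠ 0 → D ⊆ thicken n A ∧ A ⊆ thicken n D)
    (hrange : ∀ A D, f A D ≠ 0 → setRange A ≤ M ∧ setRange D ≤ M) :
    ∑ A ∈ shapes M, ∑ D ∈ (Finset.Icc (-n : ℤ) (M + n)).powerset, f A D =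
      ∑ D ∈ shapes M, ∑ A ∈ (Finset.Icc (-n : ℤ) (M + n)).powerset, f A D := by
  have h1 : ∀ A ∈ shapes M, ∑ D ∈ (Finset.Icc (-n : ℤ) (M + n)).powerset, f A D =
      ∑ D ∈ shapes M, ∑ x ∈ Finset.Icc (-n : ℤ) n, f A (shiftSet D x) := fun A hA =>
    sum_powerset_eq_sum_shapes (f A) fun D hD =>
      have ⟨h, h'⟩ := min'_mem_Icc_of_shape hA (hsub A D hD).1 (hsub A D hD).2
      ⟨h, (hrange A D hD).2, h'⟩
  have h2 : ∀ D ∈ shapes M, ∑ A ∈ (Finset.Icc (-n : ℤ) (M + n)).powerset, f A D =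
      ∑ A ∈ shapes M, ∑ x ∈ Finset.Icc (-n : ℤ) n, f (shiftSet A x) D := fun D hD =>
    sum_powerset_eq_sum_shapes (f · D) fun A hA =>
      have ⟨h, h'⟩ := min'_mem_Icc_of_shape hD (hsub A D hA).2 (hsub A D hA).1
      ⟨h, (hrange A D hA).1, h'⟩
  rw [Finset.sum_congr rfl h1, Finset.sum_congr rfl h2, Finset.sum_comm]
  refine Finset.sum_congr rfl fun D _ => Finset.sum_congr rfl fun A _ => ?_
  -- By invariance `f A (D + x) = f (A - x) D`, so the inner sums match under `x ↦ -x`.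
  refine Finset.sum_nbij' (fun x => -x) (fun x => -x) ?_ ?_ ?_ ?_ ?_
  · intro x hx; rw [Finset.mem_Icc] at hx ⊢; omega
  · intro x hx; rw [Finset.mem_Icc] at hx ⊢; omega
  · simp
  · simp
  · intro x _
    rw [← hshift A (shiftSet D x) (-x), shiftSet_shiftSet, add_neg_cancel, shiftSet_zero]

end MassTransport

/-! ### Semisimplicity of the commutator with a Hermitian operator -/

section Semisimple

variable {d : ℕ} [NeZero d]

/-- Operators on the empty region are scalars, which every derivation kills. The sums over `shapes`
see only nonempty regions, so this component needs its own argument. -/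
theorem comm_empty {n : ℕ} {Φ : FormalOp d} (hΦ : AtMostLocal n Φ) (Ψ : FormalOp d) :
    comm Φ Ψ ∅ = 0 := by
  obtain ⟨δ, hδ⟩ := exists_isAd_pairing hΦ
  refine eq_zero_of_pairing_conjTranspose ?_
  rw [pairing_comm hΦ hδ, LinearMap.neg_apply, LinearMap.comp_apply,
    hδ.eq_commutator hΦ subset_rfl, ofOp_mul_comm (Finset.disjoint_empty_right _), sub_self,
    map_zero, neg_zero]

/-- The commutator of `Φ` with an operator on `A` is supported in `thicken n A`; this supplies the
finite range required by `sum_shapes_comm`. -/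
theorem IsAd.trace_mul_eq_zero {n : ℕ} {Φ : FormalOp d} (hΦ : AtMostLocal n Φ)
    {δ : LocalAlg d →ₗ[ℂ] LocalAlg d} (hδ : IsAd locTrace (pairing Φ) δ) {A D : Finset ℤ}
    (X : Op d A) {Y : Op d D} (hY : Y ∈ tracelessOps d D) (hD : ¬ D ⊆ thicken n A) :
    locTrace (ofOp D Y * δ (ofOp A X)) = 0 := by
  have hmem : δ (ofOp A X) ∈ (ofOp (d := d) (thicken n A)).range := by
    rw [hδ.eq_commutator hΦ subset_rfl]
    have h1 : ofOp _ (restrict Φ (thicken n A)) ∈ (ofOp (d := d) (thicken n A)).range := ⟨_, rfl⟩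
    have h2 := ofOp_mem_range (subset_thicken n A) X
    exact sub_mem (mul_mem h1 h2) (mul_mem h2 h1)
  obtain ⟨Z, hZ⟩ := hmem
  rw [← hZ]
  exact locTrace_mul_eq_zero hD hY Z

-- With `K = [H, Φ]`, consider `f A D = tr (K(D) [H, Φ(A)*])`, summed over pairs modulo simultaneous
-- translation. Summing over `D` first gives `-tr ([H, K] Φ(A)*) = 0`. Summing over `A` first, after
-- moving `ad H` onto `K(D)` and using `[H, Φ*] = -K*`, gives `-tr (K(D) K(D)*)`. Equality of the
-- two orders forces the squared norms of `K` on all shapes to add up to zero.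
open scoped ComplexOrder in
theorem comm_eq_zero_of_comm_comm_eq_zero {n k : ℕ} {H Φ : FormalOp d}
    (hH : AtMostLocal (n + 1) H) (hherm : IsHermitian H) (hHinv : IsTranslationInvariant H)
    (hΦ : AtMostLocal k Φ) (hΦinv : IsTranslationInvariant Φ)
    (hK : IsTranslationInvariant (comm H Φ)) (h : comm H (comm H Φ) = 0) : comm H Φ = 0 := by
  obtain ⟨δ, hδ⟩ := exists_isAd_pairing hH
  have hKloc := hH.comm hΦ
  have hadj : comm H (adjoint Φ) = -adjoint (comm H Φ) := by
    have := adjoint_comm hH Φ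
    rwa [hherm.adjoint_eq] at this
  set K := comm H Φ with hKdef
  set M := n + k with hM
  set f : Finset ℤ → Finset ℤ → ℂ := fun A D =>
    locTrace (ofOp D (K D : Op d D) * δ (ofOp A (adjoint Φ A : Op d A))) with hf
  have hf' : ∀ A D, f A D =
      -locTrace (ofOp A (adjoint Φ A : Op d A) * δ (ofOp D (K D : Op d D))) := fun A D =>
    hδ.trace_mul _ _
  have hδshift : ∀ x X, shiftAlg x (δ X) = δ (shiftAlg x X) := fun x X =>
    hδ.map_comp locTrace_nondegenerate (shiftAlg_surjective x) (locTrace_shiftAlg x)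
      (fun X Y => by
        rw [LinearMap.comp_apply, AlgHom.toLinearMap_apply, pairing_shiftAlg fun A => hHinv A x]
        exact hδ X Y) X
  have hmem : ∀ {A : Finset ℤ}, A ∈ shapes M → ∀ X : Op d A,
      δ (ofOp A X) ∈ (ofOp (d := d) (Finset.Icc (-(n + 1 : ℕ) : ℤ) (M + (n + 1 : ℕ)))).range := by
    intro A hA X
    have hsub : thicken (n + 1) A ⊆ Finset.Icc (-(n + 1 : ℕ) : ℤ) (M + (n + 1 : ℕ)) := by
      intro b hb
      obtain ⟨a, ha, hab⟩ := Finset.mem_biUnion.1 hb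
      have := (mem_shapes.1 hA).1 a ha
      rw [Finset.mem_Icc] at hab ⊢
      omega
    rw [hδ.eq_commutator hH hsub]
    have h1 : ofOp _ (restrict H (Finset.Icc (-(n + 1 : ℕ) : ℤ) (M + (n + 1 : ℕ)))) ∈
      (ofOp (d := d) (Finset.Icc (-(n + 1 : ℕ) : ℤ) (M + (n + 1 : ℕ)))).range := ⟨_, rfl⟩
    have h2 := ofOp_mem_range ((subset_thicken _ A).trans hsub) X
    exact sub_mem (mul_mem h1 h2) (mul_mem h2 h1)
  have hsum := sum_shapes_comm (M := M) (n := n + 1) f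
    (fun A D x => by
      simp only [hf]
      rw [hK, hΦinv.adjoint, ← shiftAlg_ofOp, ← shiftAlg_ofOp, ← hδshift, ← map_mul,
        locTrace_shiftAlg])
    (fun A D hne => by
      constructor
      · by_contra hc
        exact hne (hδ.trace_mul_eq_zero hH _ (K D).2 hc)
      · by_contra hc
        refine hne ?_
        rw [hf', hδ.trace_mul_eq_zero hH _ (adjoint Φ A).2 hc, neg_zero])
    -- The common bound `M = n + k` covers `K`, which has range at most `n + k`, and `Φ*`, which has
    -- range at most `k`.
    (fun A D hne => by
      constructor
      · refine (hΦ.adjoint A fun hz => hne ?_).trans (Nat.le_add_left _ _)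
        simp [hf, hz]
      · refine hKloc D fun hz => hne ?_
        simp [hf, hz])
  have hleft : ∀ A ∈ shapes M,
      ∑ D ∈ (Finset.Icc (-(n + 1 : ℕ) : ℤ) (M + (n + 1 : ℕ))).powerset, f A D = 0 := by
    intro A hA
    rw [← pairing_eq_sum K (hmem hA _)]
    have := congrArg (fun g => g (ofOp A (adjoint Φ A : Op d A))) (pairing_comm hH hδ K)
    simpa [h, pairing_zero] using this
  have hright : ∀ D ∈ shapes M,
      ∑ A ∈ (Finset.Icc (-(n + 1 : ℕ) : ℤ) (M + (n + 1 : ℕ))).powerset, f A D =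
        -normTrace D ((K D : Op d D) * (K D : Op d D).conjTranspose) := by
    intro D hD
    rw [Finset.sum_congr rfl fun A _ => hf' A D, Finset.sum_neg_distrib,
      ← pairing_eq_sum (adjoint Φ) (hmem hD _)]
    have := congrArg (fun g => g (ofOp D (K D : Op d D))) (pairing_comm hH hδ (adjoint Φ))
    simp only [LinearMap.neg_apply, LinearMap.comp_apply] at this
    rw [← this, hadj, pairing_neg, LinearMap.neg_apply, pairing_traceless _ (K D).2, adjoint_apply,
      normTrace_mul_comm]
  rw [Finset.sum_eq_zero hleft, Finset.sum_congr rfl hright, Finset.sum_neg_distrib, zero_eq_neg,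
    Finset.sum_eq_zero_iff_of_nonneg fun D _ => normTrace_mul_conjTranspose_nonneg _] at hsum
  funext D
  by_cases hne : D.Nonempty
  · by_contra hD
    obtain ⟨A, hA, hAD⟩ := exists_shape hne (hKloc D hD)
    have hA0 := eq_zero_of_normTrace_mul_conjTranspose (hsum A hA)
    refine hD (Subtype.ext ?_)
    -- The left end depends on `D` itself, so it is abstracted before `D` can be replaced by a
    -- translated shape.
    generalize D.min' hne = m at hAD
    subst hAD
    rw [hK, hA0]
    rfl
  · rw [Finset.not_nonempty_iff_eq_empty.1 hne]
    exact comm_empty hH Φ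

end Semisimple

/-! ### The boost operator and the tower of charges -/

section Boost

variable {d : ℕ}

/-- The leftmost site of a region. -/
noncomputable def minSite (A : Finset ℤ) : ℤ := if h : A.Nonempty then A.min' h else 0

theorem minSite_eq {A : Finset ℤ} {j : ℤ} (hj : j ∈ A) (h : ∀ a ∈ A, j ≤ a) : minSite A = j := by
  rw [minSite, dif_pos ⟨j, hj⟩]
  exact le_antisymm (A.min'_le j hj) (h _ (A.min'_mem _))

theorem minSite_shiftSet {A : Finset ℤ} (hA : A.Nonempty) (x : ℤ) :
    minSite (shiftSet A x) = minSite A + x := by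
  refine minSite_eq ?_ fun a ha => ?_
  · rw [mem_shiftSet, minSite, dif_pos hA]
    simpa using A.min'_mem hA
  · rw [minSite, dif_pos hA]
    have := A.min'_le _ (mem_shiftSet.1 ha)
    omega

variable (h2 : (j : ℤ) → tracelessOps d {j, j + 1}) (h1 : (j : ℤ) → tracelessOps d {j})

variable {h2 h1} in
theorem eq_of_siteTerm_ne_zero {j : ℤ} {A : Finset ℤ} (h : siteTerm h2 h1 j A ≠ 0) :
    A = {j, j + 1} ∨ A = {j} := by
  by_contra! hc
  exact h (by simp [siteTerm, Pi.single_eq_of_ne hc.1, Pi.single_eq_of_ne hc.2])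

variable {h2 h1} in
theorem minSite_eq_of_siteTerm_ne_zero {j : ℤ} {A : Finset ℤ} (h : siteTerm h2 h1 j A ≠ 0) :
    minSite A = j := by
  rcases eq_of_siteTerm_ne_zero h with rfl | rfl <;> refine minSite_eq (by simp) ?_ <;> simp

/-- Both kinds of term attached to `j` have leftmost site `j`, so at most one summand is nonzero on
a given region. The boost therefore weights `H` by the leftmost site. -/
theorem hamiltonian_apply (A : Finset ℤ) :
    hamiltonian h2 h1 A = siteTerm h2 h1 (minSite A) A :=
  finsum_eq_single _ _ fun j hj => by
    by_contra h
    exact hj (minSite_eq_of_siteTerm_ne_zero h).symm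

theorem boost_apply (C : FormalOp d) (A : Finset ℤ) :
    boost h2 h1 C A = (minSite A : ℂ) • hamiltonian h2 h1 A + C A := by
  rw [hamiltonian_apply, boost, Pi.add_apply, formalSum,
    finsum_eq_single _ (minSite A), Pi.smul_apply]
  intro j hj
  by_contra h
  refine hj (minSite_eq_of_siteTerm_ne_zero (h2 := h2) (h1 := h1) fun hz => h ?_).symm
  rw [Pi.smul_apply, hz, smul_zero]

theorem hamiltonian_empty : hamiltonian h2 h1 ∅ = 0 := by
  rw [hamiltonian_apply]
  by_contra h
  rcases eq_of_siteTerm_ne_zero h with h | h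
  · exact (Finset.insert_ne_empty _ _ h.symm).elim
  · exact (Finset.singleton_ne_empty _ h.symm).elim

theorem atMostLocal_hamiltonian : AtMostLocal 2 (hamiltonian h2 h1) := by
  intro A hA
  rw [hamiltonian_apply] at hA
  refine setRange_le fun a ha b hb => ?_
  rcases eq_of_siteTerm_ne_zero hA with h | h <;> rw [h] at ha hb <;>
    simp only [Finset.mem_insert, Finset.mem_singleton] at ha hb <;> push_cast <;> omega

theorem atMostLocal_boost {C : FormalOp d} (hC : AtMostLocal 1 C) :
    AtMostLocal 2 (boost h2 h1 C) := by
  intro A hA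
  by_cases hz : hamiltonian h2 h1 A = 0
  · rw [boost_apply, hz, smul_zero, zero_add] at hA
    exact (hC A hA).trans one_le_two
  · exact atMostLocal_hamiltonian h2 h1 A hz

variable {h2 h1} in
theorem boost_shiftSet (hinv : IsTranslationInvariant (hamiltonian h2 h1)) {C : FormalOp d}
    (hCinv : IsTranslationInvariant C) (A : Finset ℤ) (x : ℤ) :
    (boost h2 h1 C (shiftSet A x) : Op d (shiftSet A x)) =
      shiftOp x ((boost h2 h1 C + (x : ℂ) • hamiltonian h2 h1) A : Op d A) := by
  simp only [Pi.add_apply, Pi.smul_apply, boost_apply, Submodule.coe_add, Submodule.coe_smul,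
    shiftOp_add, shiftOp_smul, hinv A x, hCinv A x]
  rcases A.eq_empty_or_nonempty with rfl | hA
  -- The default `minSite ∅ = 0` does not move under translations; this is harmless because `H` has
  -- no component on the empty set.
  · have h0 : shiftOp x ((hamiltonian h2 h1 ∅ : tracelessOps d ∅) : Op d ∅) = 0 := by
      rw [hamiltonian_empty]; rfl
    simp [h0]
  · rw [minSite_shiftSet hA, Int.cast_add, add_smul]
    abel

end Boost

/-! ### Induction along the tower of charges -/

section Charges

variable {d : ℕ} [NeZero d]

theorem charge_succ (H B : FormalOp d) {n : ℕ} (hn : 2 ≤ n) :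
    charge H B (n + 1) = comm B (charge H B n) := by
  obtain ⟨n, rfl⟩ := Nat.exists_eq_add_of_le' hn
  rfl

theorem atMostLocal_charge {H B : FormalOp d} (hH : AtMostLocal 2 H) (hB : AtMostLocal 2 B)
    {n : ℕ} (hn : 2 ≤ n) : AtMostLocal n (charge H B n) := by
  induction n, hn using Nat.le_induction with
  | base => exact hH
  | succ n hn ih =>
    rw [charge_succ H B hn, add_comm]
    exact AtMostLocal.comm (n := 1) hB ih

theorem isTranslationInvariant_comm_of_invariant {n : ℕ} {Φ Ψ : FormalOp d}
    (hΦ : AtMostLocal n Φ) (hΦinv : IsTranslationInvariant Φ) (hΨ : IsTranslationInvariant Ψ) :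
    IsTranslationInvariant (comm Φ Ψ) := by
  refine isTranslationInvariant_comm (Θ := 0) hΦ atMostLocal_zero (fun A x => ?_) hΨ
    (zero_comm Ψ)
  rw [smul_zero, add_zero, hΦinv]

/-- The charges are translation invariant and conserved, provided that translations change `B` by
multiples of `H` and that the first nontrivial charge is conserved. -/
theorem charge_conserved {H B : FormalOp d} (hH : AtMostLocal 2 H) (hB : AtMostLocal 2 B)
    (hherm : IsHermitian H) (hinv : IsTranslationInvariant H)
    (hBinv : ∀ A (x : ℤ),
      (B (shiftSet A x) : Op d (shiftSet A x)) = shiftOp x ((B + (x : ℂ) • H) A : Op d A))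
    (hcons : comm H (charge H B 3) = 0) {n : ℕ} (hn : 2 ≤ n) :
    IsTranslationInvariant (charge H B n) ∧ comm H (charge H B n) = 0 := by
  have h3 : comm B H = charge H B 3 := rfl
  induction n, hn using Nat.le_induction with
  | base => exact ⟨hinv, comm_self hH⟩
  | succ n hn ih =>
    obtain ⟨hQinv, hQ⟩ := ih
    have hQloc := atMostLocal_charge hH hB hn
    have hQ'loc := atMostLocal_charge hH hB (hn.trans n.le_succ)
    have h3loc : AtMostLocal 3 (charge H B 3) := atMostLocal_charge hH hB (by norm_num)
    have hQ'inv : IsTranslationInvariant (charge H B (n + 1)) := by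
      rw [charge_succ H B hn]
      exact isTranslationInvariant_comm hB hH hBinv hQinv hQ
    refine ⟨hQ'inv, ?_⟩
    -- Jacobi for `[[B, H], Qₙ]`, where the term `[B, [H, Qₙ]]` vanishes by induction.
    have key : comm (charge H B 3) (charge H B n) = -comm H (charge H B (n + 1)) := by
      rw [← h3, comm_comm hB hH h3loc, hQ, comm_zero hB, zero_sub, charge_succ H B hn]
    refine comm_eq_zero_of_comm_comm_eq_zero (n := 1) hH hherm hinv hQ'loc hQ'inv
      (isTranslationInvariant_comm_of_invariant hH hinv hQ'inv) ?_
    -- Jacobi for `[[H, Q₃], Qₙ]`, whose inner bracket is zero and hence local; with `key` it yields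
    -- `[H, [H, Qₙ₊₁]] = 0`.
    have h := comm_comm hH h3loc (hcons ▸ atMostLocal_zero) (charge H B n)
    rw [hcons, zero_comm, hQ, comm_zero h3loc, sub_zero, key, comm_neg hH] at h
    exact neg_eq_zero.1 h.symm

/-- Conserved charges generated by a boost commute with each other. -/
theorem comm_charge_charge {H B : FormalOp d} (hH : AtMostLocal 2 H) (hB : AtMostLocal 2 B)
    (hcons : ∀ n, 2 ≤ n → comm H (charge H B n) = 0) {m n : ℕ} (hm : 2 ≤ m) (hn : 2 ≤ n) :
    comm (charge H B m) (charge H B n) = 0 := by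
  -- The step at `m` uses the claim for both `n` and `n + 1`, so `n` must stay general.
  induction m, hm using Nat.le_induction generalizing n with
  | base => exact hcons n hn
  | succ m hm ih =>
    have hQ := atMostLocal_charge hH hB hm
    have hQ' := atMostLocal_charge hH hB (hm.trans m.le_succ)
    rw [charge_succ H B hm] at hQ' ⊢
    rw [comm_comm hB hQ hQ', ih hn, comm_zero hB, ← charge_succ H B hn, ih (hn.trans n.le_succ),
      sub_zero]

end Charges

end SpinChain

open SpinChain in
theorem theorem1 {d : ℕ} [NeZero d]
    (h2 : (j : ℤ) → tracelessOps d {j, j + 1}) (h1 : (j : ℤ) → tracelessOps d {j})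
    (hherm : IsHermitian (hamiltonian h2 h1))
    (hinv : IsTranslationInvariant (hamiltonian h2 h1))
    (C : FormalOp d) (hC : AtMostLocal 1 C) (hCinv : IsTranslationInvariant C)
    (Q : ℕ → FormalOp d) (hQ : Q = charge (hamiltonian h2 h1) (boost h2 h1 C))
    (hcons : comm (hamiltonian h2 h1) (Q 3) = 0) :
    (∀ n, 2 ≤ n → AtMostLocal n (Q n) ∧ IsTranslationInvariant (Q n) ∧
      comm (hamiltonian h2 h1) (Q n) = 0) ∧
    (∀ m n, 2 ≤ m → 2 ≤ n → comm (Q m) (Q n) = 0) := by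
  subst hQ
  have hH := atMostLocal_hamiltonian h2 h1
  have hB := atMostLocal_boost h2 h1 hC
  have hQ := fun n (hn : 2 ≤ n) =>
    charge_conserved hH hB hherm hinv (boost_shiftSet hinv hCinv) hcons hn
  exact ⟨fun n hn => ⟨atMostLocal_charge hH hB hn, hQ n hn⟩,
    fun m n hm hn => comm_charge_charge hH hB (fun n hn => (hQ n hn).2) hm hn⟩
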